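/- Let $S$ be the first-order language without identity, constants or function symbols, with countably many predicate letters $X^n_i$ of each arity $n\ge 0$. Let $L$ be a countable first-order language with identity, and let $T$ be an $L$-theory, i.e. a set of $L$-sentences closed under logical consequence. Write $\mathsf{V}(T)$ for the set of all $S$-sentences $\varphi$ such that every $L$-sentence obtained from $\varphi$ by replacing (without capture of variables) each atomic formula $X^n_i(t_1,\dots,t_n)$ by $\psi^n_i(t_1,\dots,t_n)$, for some choice of $L$-formulas $\psi^n_i(y_1,\dots,y_n)$ whose free variables are exactly $y_1,\dots,y_n$, belongs to $T$. Identify $S$-sentences with natural numbers through an effective Gödel numbering. Say that $T$ has the strict order property if, for some $k$, some parameter-free $L$-formula $\theta(\bar x,\bar y)$ in two $k$-tuples of variables defines in some model $M$ of $T$ a preorder on $M^k$ with an infinite strict chain; otherwise $T$ is NSOP. **Theorem.** If $T$ is a complete (and consistent) NSOP theory with infinite models which is not $\aleph_0$-categorical, then $\mathsf{V}(T)$ computes $\emptyset'$; that is, the halting set $\emptyset'=\{e : \text{the } e\text{-th partial recursive function is defined at } e\}$ is Turing reducible to $\mathsf{V}(T)$. -/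

import Mathlib

universe u v

open FirstOrder.Language
open scoped FirstOrder

/-- Formulas of the schematic language `S`: first-order logic without identity, without constant
or function symbols, and with countably many predicate letters `X^n_i` (`i : ℕ`) of each arity
`n`. `SchemaFormula m` is the type of formulas whose free variables are among `x_0, …, x_{m-1}`;
in `all φ` the variable `x_m` of `φ` is universally quantified. The other connectives and the
existential quantifier are the usual abbreviations. -/
inductive SchemaFormula : ℕ → Type
  | falsum {m : ℕ} : SchemaFormula m
  | rel {m : ℕ} (n i : ℕ) (x : Fin n → Fin m) : SchemaFormula m
  | imp {m : ℕ} (φ ψ : SchemaFormula m) : SchemaFormula m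
  | all {m : ℕ} (φ : SchemaFormula (m + 1)) : SchemaFormula m

/-- Sentences of the schematic language `S`. -/
abbrev SchemaSentence : Type := SchemaFormula 0

namespace SchemaFormula

/-- The Gödel number of a formula of `S`. -/
def code : {m : ℕ} → SchemaFormula m → ℕ
  | _, falsum => 0
  | _, rel _ i x => 3 * Nat.pair i (Encodable.encode (List.ofFn fun j => (x j : ℕ))) + 1
  | _, imp φ ψ => 3 * Nat.pair φ.code ψ.code + 2
  | _, all φ => 3 * φ.code + 3

theorem code_injective {m : ℕ} : Function.Injective (code (m := m)) := by
  intro φ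
  induction φ with
  | falsum =>
    intro ψ h
    cases ψ <;> simp only [code] at h <;> first | rfl | omega
  | rel n i x =>
    intro ψ h
    cases ψ with
    | rel n' i' x' =>
      simp only [code] at h
      obtain ⟨rfl, h2⟩ := Nat.pair_eq_pair.1 (by omega :
        Nat.pair i (Encodable.encode (List.ofFn fun j => (x j : ℕ))) =
          Nat.pair i' (Encodable.encode (List.ofFn fun j => (x' j : ℕ))))
      have h3 := Encodable.encode_injective h2
      have hn : n = n' := by simpa using congrArg List.length h3
      subst hn
      have h4 := List.ofFn_injective h3
      have hx : x = x' := funext fun j => Fin.ext (congrFun h4 j)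
      rw [hx]
    | _ => simp only [code] at h; omega
  | imp φ₁ φ₂ ih₁ ih₂ =>
    intro ψ h
    cases ψ with
    | imp ψ₁ ψ₂ =>
      simp only [code] at h
      obtain ⟨h1, h2⟩ := Nat.pair_eq_pair.1 (by omega :
        Nat.pair φ₁.code φ₂.code = Nat.pair ψ₁.code ψ₂.code)
      rw [ih₁ h1, ih₂ h2]
    | _ => simp only [code] at h; omega
  | all φ ih =>
    intro ψ h
    cases ψ with
    | all ψ =>
      simp only [code] at h
      rw [ih (by omega : φ.code = ψ.code)]
    | _ => simp only [code] at h; omega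

/-- The substitution instance of a formula of `S` in which every atomic formula
`X^n_i(t_1, …, t_n)` is replaced by `ψ^n_i(t_1, …, t_n)`, where `ψ n i` is an `L`-formula in the
variables `y_1, …, y_n`. No variable is captured, since bound variables of `ψ n i` are
renumbered. -/
def substitute {L : FirstOrder.Language.{u, v}} (ψ : (n : ℕ) → ℕ → L.Formula (Fin n)) :
    {m : ℕ} → SchemaFormula m → L.BoundedFormula Empty m
  | _, falsum => BoundedFormula.falsum
  | _, rel n i x =>
    BoundedFormula.relabel (k := 0) (fun j => (Sum.inr (x j) : Empty ⊕ Fin _)) (ψ n i)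
  | _, imp φ χ => (substitute ψ φ).imp (substitute ψ χ)
  | _, all φ => (substitute ψ φ).all

end SchemaFormula

/-- The set of validities `V(T)` of an `L`-theory `T`: the sentences of `S` all of whose
substitution instances, by `L`-formulas `ψ^n_i(y_1, …, y_n)` with free variables exactly
`y_1, …, y_n`, belong to `T`. -/
def validities {L : FirstOrder.Language.{u, v}} (T : L.Theory) : Set SchemaSentence :=
  {φ | ∀ ψ : (n : ℕ) → ℕ → L.Formula (Fin n),
    (∀ n i, (ψ n i).freeVarFinset = Finset.univ) → φ.substitute ψ ∈ T}

/-- A set of sentences is closed under logical consequence. -/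
def ClosedUnderConsequence {L : FirstOrder.Language.{u, v}} (T : L.Theory) : Prop :=
  ∀ σ : L.Sentence, T ⊨ᵇ σ → σ ∈ T

/-- The strict order property: for some `k`, some `L`-formula `θ(x, y)` without parameters in two
`k`-tuples of variables defines, in some model `M` of `T`, a preorder on `M^k` with an infinite
strict chain. -/
def HasStrictOrderProperty {L : FirstOrder.Language.{u, v}} (T : L.Theory) : Prop :=
  ∃ (k : ℕ) (θ : L.Formula (Fin k ⊕ Fin k)) (M : Theory.ModelType.{u, v, max u v} T),
    (∀ a : Fin k → M, θ.Realize (Sum.elim a a)) ∧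
    (∀ a b c : Fin k → M, θ.Realize (Sum.elim a b) → θ.Realize (Sum.elim b c) →
      θ.Realize (Sum.elim a c)) ∧
    ∃ s : ℕ → Fin k → M, ∀ i : ℕ,
      θ.Realize (Sum.elim (s i) (s (i + 1))) ∧ ¬ θ.Realize (Sum.elim (s (i + 1)) (s i))

open Classical in
/-- The characteristic function of a set of natural numbers. -/
noncomputable def charFun (A : Set ℕ) : ℕ →. ℕ :=
  fun n => Part.some (if n ∈ A then 1 else 0)

/-- The halting set `∅'`: the indices `e` such that the `e`-th partial recursive function is
defined at `e`. -/
def haltingSet : Set ℕ :=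
  {e | ((Denumerable.ofNat Nat.Partrec.Code e).eval e).Dom}

/-! Fix a code `c` whose domain is the halting set. For each `e`, the sentence `computation c e`
describes a strict weak order, arithmetic on its classes, and a run of `c` on `e`. Everything
reduces to one equivalence: `c` halts at `e` iff the negation of this sentence, read about
`n`-tuples for a suitable fixed `n`, is not in `validities T`. Its Gödel number is primitive
recursive in `e`, so `validities T` decides halting. Since `T` is complete, membership in
`validities T` is truth of all instances in a single model `M`.

If some instance of the tupled sentence holds in `M`, the order it gives on `n`-tuples is definable
without parameters. By NSOP it has no infinite descending or ascending chain, so every element has a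
finite height that strictly respects the order. The axioms force the letters to describe true facts
about heights, hence a genuine halting computation (`dom_of_realize_computation`,
`dom_of_not_mem_validities`).

Conversely, a halting computation uses only numbers below some `K`, and the axioms hold on `Fin K`
(`exists_realize_computation_of_dom`). Failure of categoricity gives, as in the Ryll-Nardzewski
theorem, an `n` with infinitely many definable sets of `n`-tuples
(`nonempty_equiv_of_finite_definableSets`). Then `n`-tuples split into `K` nonempty definable pieces
(`exists_definable_surjection`). The schematic language has no identity, so pulling the finite model
back along this partition preserves all sentences (`realize_of_surjective`,
`not_mem_validities_of_dom`). -/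

open Nat.Partrec (Code)

/-! ### Semantics of schematic formulas and the sentence `computation` -/

namespace SchemaFormula

/-- Truth of a formula of `S` in a structure where `R i` interprets the letters `X^n_i`. -/
def Realize {α : Type*} (R : ℕ → List α → Prop) : {m : ℕ} → SchemaFormula m → (Fin m → α) → Prop
  | _, falsum, _ => False
  | _, rel _ i x, w => R i (List.ofFn fun j => w (x j))
  | _, imp φ ψ, w => φ.Realize R w → ψ.Realize R w
  | _, all φ, w => ∀ a, φ.Realize R (Fin.snoc w a)

/-- Negation. -/
def neg {m : ℕ} (φ : SchemaFormula m) : SchemaFormula m := φ.imp falsum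
/-- Conjunction. -/
def conj {m : ℕ} (φ ψ : SchemaFormula m) : SchemaFormula m := (φ.imp ψ.neg).neg
/-- Disjunction. -/
def disj {m : ℕ} (φ ψ : SchemaFormula m) : SchemaFormula m := φ.neg.imp ψ
/-- Existential quantification. -/
def ex {m : ℕ} (φ : SchemaFormula (m + 1)) : SchemaFormula m := φ.neg.all.neg
/-- Unary atoms. -/
def rel₁ {m : ℕ} (i : ℕ) (x : Fin m) : SchemaFormula m := rel 1 i ![x]
/-- Binary atoms. -/
def rel₂ {m : ℕ} (i : ℕ) (x y : Fin m) : SchemaFormula m := rel 2 i ![x, y]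
/-- Ternary atoms. -/
def rel₃ {m : ℕ} (i : ℕ) (x y z : Fin m) : SchemaFormula m := rel 3 i ![x, y, z]
/-- Conjunction of a list of formulas. -/
def conjList {m : ℕ} (l : List (SchemaFormula m)) : SchemaFormula m :=
  l.foldr conj (falsum.imp falsum)

section Realize

variable {α : Type*} {R : ℕ → List α → Prop} {m : ℕ} {w : Fin m → α}

@[simp] theorem realize_falsum : (falsum : SchemaFormula m).Realize R w ↔ False := Iff.rfl

@[simp] theorem realize_imp {φ ψ : SchemaFormula m} :
    (φ.imp ψ).Realize R w ↔ (φ.Realize R w → ψ.Realize R w) := Iff.rfl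

@[simp] theorem realize_all {φ : SchemaFormula (m + 1)} :
    φ.all.Realize R w ↔ ∀ a, φ.Realize R (Fin.snoc w a) := Iff.rfl

@[simp] theorem realize_neg {φ : SchemaFormula m} : φ.neg.Realize R w ↔ ¬ φ.Realize R w := Iff.rfl

@[simp] theorem realize_conj {φ ψ : SchemaFormula m} :
    (φ.conj ψ).Realize R w ↔ φ.Realize R w ∧ ψ.Realize R w := by
  simp [conj]

@[simp] theorem realize_disj {φ ψ : SchemaFormula m} :
    (φ.disj ψ).Realize R w ↔ φ.Realize R w ∨ ψ.Realize R w := by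
  simp [disj, or_iff_not_imp_left]

@[simp] theorem realize_ex {φ : SchemaFormula (m + 1)} :
    φ.ex.Realize R w ↔ ∃ a, φ.Realize R (Fin.snoc w a) := by
  simp [ex]

@[simp] theorem realize_rel₁ {i : ℕ} {x : Fin m} :
    (rel₁ i x).Realize R w ↔ R i [w x] := by
  simp [rel₁, Realize]

@[simp] theorem realize_rel₂ {i : ℕ} {x y : Fin m} :
    (rel₂ i x y).Realize R w ↔ R i [w x, w y] := by
  simp [rel₂, Realize]

@[simp] theorem realize_rel₃ {i : ℕ} {x y z : Fin m} :
    (rel₃ i x y z).Realize R w ↔ R i [w x, w y, w z] := by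
  simp [rel₃, Realize]

@[simp] theorem realize_conjList {l : List (SchemaFormula m)} :
    (conjList l).Realize R w ↔ ∀ φ ∈ l, φ.Realize R w := by
  induction l with
  | nil => simp [conjList]
  | cons φ l ih => simpa [conjList] using fun _ => ih

end Realize

/-- The index of the binary letter for the graph of the function with code `c`. -/
def evalIndex (c : Code) : ℕ := c.encodeCode + 3

/-- Axioms for a strict weak order (letter `0`), its successor relation (letter `1`), its
incomparability relation (letter `2`), its least elements (unary letter `0`), and the graph of the
pairing function (ternary letter `0`). -/
def orderAxioms : List SchemaSentence :=
  [all (neg (rel₂ 0 0 0)),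
   all (all (all ((rel₂ 0 0 1).imp ((rel₂ 0 1 2).imp (rel₂ 0 0 2))))),
   all (all (all ((rel₂ 0 0 1).imp (disj (rel₂ 0 0 2) (rel₂ 0 2 1))))),
   all (all ((rel₂ 1 0 1).imp (rel₂ 0 0 1))),
   all (all (all ((rel₂ 1 0 1).imp ((rel₂ 0 2 1).imp (neg (rel₂ 0 0 2)))))),
   all (all ((rel₂ 2 0 1).imp (neg (disj (rel₂ 0 0 1) (rel₂ 0 1 0))))),
   all (all ((rel₁ 0 0).imp (neg (rel₂ 0 1 0)))),
   all (all (all ((rel₃ 0 0 1 2).imp (disj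
    (conj (rel₁ 0 0) (conj (rel₁ 0 1) (rel₁ 0 2)))
    (ex (ex (ex (conj (rel₂ 1 3 0) (conj (rel₃ 0 3 4 5)
      (disj (conj (rel₂ 1 4 1) (conj (rel₂ 0 1 2) (rel₂ 2 5 2)))
      (disj (conj (rel₂ 1 4 5) (conj (rel₂ 2 5 1) (rel₁ 0 2)))
      (disj (conj (rel₂ 0 5 4) (conj (rel₂ 2 4 1) (rel₂ 1 5 2)))
        (conj (rel₂ 2 4 5) (conj (rel₁ 0 1) (rel₂ 1 5 2)))))))))))))))]

/-- The axiom describing how a value of the function with code `c` arises. -/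
def evalAxiom : Code → SchemaSentence
  | .zero => all (all ((rel₂ (evalIndex .zero) 0 1).imp (rel₁ 0 1)))
  | .succ => all (all ((rel₂ (evalIndex .succ) 0 1).imp (rel₂ 1 0 1)))
  | .left => all (all ((rel₂ (evalIndex .left) 0 1).imp (ex (rel₃ 0 0 1 2))))
  | .right => all (all ((rel₂ (evalIndex .right) 0 1).imp (ex (rel₃ 0 0 2 1))))
  | .pair f g => all (all ((rel₂ (evalIndex (.pair f g)) 0 1).imp
      (ex (ex (conj (rel₂ (evalIndex f) 0 2) (conj (rel₂ (evalIndex g) 0 3) (rel₃ 0 1 2 3)))))))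
  | .comp f g => all (all ((rel₂ (evalIndex (.comp f g)) 0 1).imp
      (ex (conj (rel₂ (evalIndex g) 0 2) (rel₂ (evalIndex f) 2 1)))))
  | .prec f g => all (all ((rel₂ (evalIndex (.prec f g)) 0 1).imp
      (ex (ex (conj (rel₃ 0 0 2 3) (disj (conj (rel₁ 0 3) (rel₂ (evalIndex f) 2 1))
        (ex (ex (ex (ex (ex (conj (rel₂ 1 4 3) (conj (rel₃ 0 5 2 4)
          (conj (rel₂ (evalIndex (.prec f g)) 5 6) (conj (rel₃ 0 7 4 6) (conj (rel₃ 0 8 2 7)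
            (rel₂ (evalIndex g) 8 1)))))))))))))))))
  | .rfind' f => all (all ((rel₂ (evalIndex (.rfind' f)) 0 1).imp
      (ex (ex (ex (conj (rel₃ 0 0 2 3) (conj (rel₂ (evalIndex f) 0 4)
        (disj (conj (rel₁ 0 4) (rel₂ 2 3 1))
          (ex (ex (ex (conj (rel₂ 1 5 4) (conj (rel₂ 1 3 6) (conj (rel₃ 0 7 2 6)
            (rel₂ (evalIndex (.rfind' f)) 7 1)))))))))))))))

/-- The axioms for all subcodes of `c`. -/
def evalAxioms : Code → List SchemaSentence
  | .pair f g => evalAxiom (.pair f g) :: (evalAxioms f ++ evalAxioms g)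
  | .comp f g => evalAxiom (.comp f g) :: (evalAxioms f ++ evalAxioms g)
  | .prec f g => evalAxiom (.prec f g) :: (evalAxioms f ++ evalAxioms g)
  | .rfind' f => evalAxiom (.rfind' f) :: evalAxioms f
  | c => [evalAxiom c]

/-- Every element of the unary letter `i + 1` is a successor of an element of the letter `i`. -/
def numeralAxiom (i : ℕ) : SchemaSentence :=
  all ((rel₁ (i + 1) 0).imp (ex (conj (rel₁ i 1) (rel₂ 1 1 0))))

/-- The conjunction of the first `e` numeral axioms. -/
def numeralAxioms : ℕ → SchemaSentence
  | 0 => falsum.imp falsum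
  | e + 1 => conj (numeralAxiom e) (numeralAxioms e)

/-- The function with code `c` has a value at the number `e`. -/
def haltsAt (c : Code) (e : ℕ) : SchemaSentence :=
  ex (ex (conj (rel₁ e 0) (rel₂ (evalIndex c) 0 1)))

/-- A sentence whose models without infinite strict chains certify that the function with code `c`
is defined at `e`. -/
def computation (c : Code) (e : ℕ) : SchemaSentence :=
  conj (conjList (orderAxioms ++ evalAxioms c)) (conj (numeralAxioms e) (haltsAt c e))

section

variable {α : Type*} {R : ℕ → List α → Prop} {w : Fin 0 → α}

/-- No axiom demands that successors or pair codes exist: each only says where an atom that holds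
comes from, with witnesses that stay small. This is why initial segments of the numbers are models.
In the pairing axiom `p'` codes the pair enumerated just before the one coded by `p`. -/
theorem realize_orderAxioms : (∀ φ ∈ orderAxioms, φ.Realize R w) ↔
    (∀ x, ¬ R 0 [x, x]) ∧ (∀ x y z, R 0 [x, y] → R 0 [y, z] → R 0 [x, z]) ∧
    (∀ x y z, R 0 [x, y] → R 0 [x, z] ∨ R 0 [z, y]) ∧
    (∀ x y, R 1 [x, y] → R 0 [x, y]) ∧
    (∀ x y z, R 1 [x, y] → R 0 [z, y] → ¬ R 0 [x, z]) ∧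
    (∀ x y, R 2 [x, y] → ¬ (R 0 [x, y] ∨ R 0 [y, x])) ∧
    (∀ x z, R 0 [x] → ¬ R 0 [z, x]) ∧
    (∀ p a b, R 0 [p, a, b] → R 0 [p] ∧ R 0 [a] ∧ R 0 [b] ∨
      ∃ p' a' b', R 1 [p', p] ∧ R 0 [p', a', b'] ∧
        (R 1 [a', a] ∧ R 0 [a, b] ∧ R 2 [b', b] ∨ R 1 [a', b'] ∧ R 2 [b', a] ∧ R 0 [b] ∨
          R 0 [b', a'] ∧ R 2 [a', a] ∧ R 1 [b', b] ∨
          R 2 [a', b'] ∧ R 0 [a] ∧ R 1 [b', b])) := by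
  simp [orderAxioms, Fin.snoc, Fin.castLT]

theorem realize_evalAxiom_prec {f g : Code} : (evalAxiom (.prec f g)).Realize R w ↔
    ∀ x y, R (evalIndex (.prec f g)) [x, y] → ∃ a m, R 0 [x, a, m] ∧
      (R 0 [m] ∧ R (evalIndex f) [a, y] ∨ ∃ m' x' i t s, R 1 [m', m] ∧ R 0 [x', a, m'] ∧
        R (evalIndex (.prec f g)) [x', i] ∧ R 0 [t, m', i] ∧ R 0 [s, a, t] ∧
        R (evalIndex g) [s, y]) := by
  simp [evalAxiom, Fin.snoc, Fin.castLT]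

/-- The element `u` serves only to say that the value `z` is not zero, so that the search moves on
from `m` to `m'`. -/
theorem realize_evalAxiom_rfind' {f : Code} : (evalAxiom (.rfind' f)).Realize R w ↔
    ∀ x y, R (evalIndex (.rfind' f)) [x, y] → ∃ a m z, R 0 [x, a, m] ∧ R (evalIndex f) [x, z] ∧
      (R 0 [z] ∧ R 2 [m, y] ∨ ∃ u m' x', R 1 [u, z] ∧ R 1 [m, m'] ∧ R 0 [x', a, m'] ∧
        R (evalIndex (.rfind' f)) [x', y]) := by
  simp [evalAxiom, Fin.snoc, Fin.castLT]

theorem realize_evalAxiom_pair {f g : Code} : (evalAxiom (.pair f g)).Realize R w ↔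
    ∀ x y, R (evalIndex (.pair f g)) [x, y] → ∃ y₁ y₂, R (evalIndex f) [x, y₁] ∧
      R (evalIndex g) [x, y₂] ∧ R 0 [y, y₁, y₂] := by
  simp [evalAxiom, Fin.snoc, Fin.castLT]

theorem realize_evalAxiom_comp {f g : Code} : (evalAxiom (.comp f g)).Realize R w ↔
    ∀ x y, R (evalIndex (.comp f g)) [x, y] → ∃ z, R (evalIndex g) [x, z] ∧
      R (evalIndex f) [z, y] := by
  simp [evalAxiom, Fin.snoc, Fin.castLT]

theorem realize_evalAxiom_zero : (evalAxiom .zero).Realize R w ↔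
    ∀ x y, R (evalIndex .zero) [x, y] → R 0 [y] := by
  simp [evalAxiom, Fin.snoc, Fin.castLT]

theorem realize_evalAxiom_succ : (evalAxiom .succ).Realize R w ↔
    ∀ x y, R (evalIndex .succ) [x, y] → R 1 [x, y] := by
  simp [evalAxiom, Fin.snoc, Fin.castLT]

theorem realize_evalAxiom_left : (evalAxiom .left).Realize R w ↔
    ∀ x y, R (evalIndex .left) [x, y] → ∃ b, R 0 [x, y, b] := by
  simp [evalAxiom, Fin.snoc, Fin.castLT]

theorem realize_evalAxiom_right : (evalAxiom .right).Realize R w ↔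
    ∀ x y, R (evalIndex .right) [x, y] → ∃ a, R 0 [x, a, y] := by
  simp [evalAxiom, Fin.snoc, Fin.castLT]

theorem realize_numeralAxiom {i : ℕ} : (numeralAxiom i).Realize R w ↔
    ∀ y, R (i + 1) [y] → ∃ x, R i [x] ∧ R 1 [x, y] := by
  simp [numeralAxiom, Fin.snoc, Fin.castLT]

theorem realize_numeralAxioms {e : ℕ} : (numeralAxioms e).Realize R w ↔
    ∀ i < e, ∀ y, R (i + 1) [y] → ∃ x, R i [x] ∧ R 1 [x, y] := by
  induction e with
  | zero => simp [numeralAxioms]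
  | succ e ih =>
    rw [numeralAxioms, realize_conj, ih, realize_numeralAxiom, Nat.forall_lt_succ_right, and_comm]

theorem realize_haltsAt {c : Code} {e : ℕ} : (haltsAt c e).Realize R w ↔
    ∃ x y, R e [x] ∧ R (evalIndex c) [x, y] := by
  simp [haltsAt, Fin.snoc, Fin.castLT]

end

end SchemaFormula

/-! ### Heights in a strict weak order without infinite chains -/

section Height

variable {α : Type*} {lt : α → α → Prop}

/-- `x` is an immediate predecessor of `y`. -/
def ImmPred (lt : α → α → Prop) (x y : α) : Prop := lt x y ∧ ∀ z, lt z y → ¬ lt x z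

open Classical in
/-- The number of immediate predecessor steps from `x` down to a minimal element. -/
noncomputable def height (hwf : WellFounded lt) : α → ℕ :=
  hwf.fix fun y ih => if h : ∃ x, ImmPred lt x y then ih h.choose h.choose_spec.1 + 1 else 0

/-- The predecessor used by `height` is chosen from the predicate `ImmPred lt · x` alone, and
elements with the same lower set share this predicate. -/
theorem height_congr (hwf : WellFounded lt) {x y : α} (h : ∀ z, lt z x ↔ lt z y) :
    height hwf x = height hwf y := by
  have hP : (fun z => ImmPred lt z x) = fun z => ImmPred lt z y := by
    funext z
    simp only [ImmPred, h]
  classical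
  have key (x : α) : height hwf x = (fun P : α → Prop =>
      if h : ∃ z, P z then height hwf h.choose + 1 else 0) (fun z => ImmPred lt z x) := by
    rw [height, WellFounded.fix_eq]
  rw [key, key, hP]

theorem height_eq_zero (hwf : WellFounded lt) {x : α} (h : ∀ z, ¬ lt z x) : height hwf x = 0 := by
  rw [height, WellFounded.fix_eq, dif_neg]
  rintro ⟨z, hz⟩
  exact h z hz.1

theorem height_eq_of_incomparable (hwf : WellFounded lt)
    (htot : ∀ x y z, lt x y → lt x z ∨ lt z y) {x y : α} (h : ¬ (lt x y ∨ lt y x)) :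
    height hwf x = height hwf y := by
  refine height_congr hwf fun z => ⟨fun hz => ?_, fun hz => ?_⟩
  · exact (htot z x y hz).resolve_right fun h' => h (.inr h')
  · exact (htot z y x hz).resolve_right fun h' => h (.inl h')

/-- The chosen immediate predecessor may differ from `x`, but any two immediate predecessors of `y`
are incomparable, hence of equal height. -/
theorem height_of_immPred (hwf : WellFounded lt)
    (htot : ∀ x y z, lt x y → lt x z ∨ lt z y) {x y : α} (h : ImmPred lt x y) :
    height hwf y = height hwf x + 1 := by
  have hex : ∃ x, ImmPred lt x y := ⟨x, h⟩
  have hy : height hwf y = height hwf hex.choose + 1 := by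
    rw [height, WellFounded.fix_eq, dif_pos hex]
  rw [hy]
  refine congrArg (· + 1) (height_eq_of_incomparable hwf htot ?_)
  rintro (h' | h')
  · exact hex.choose_spec.2 _ h.1 h'
  · exact h.2 _ hex.choose_spec.1 h'

theorem height_lt (hwf : WellFounded lt) (hwf' : WellFounded (Function.swap lt))
    (htot : ∀ x y z, lt x y → lt x z ∨ lt z y) {x y : α} (h : lt x y) :
    height hwf x < height hwf y := by
  induction y using hwf.induction generalizing x with
  | _ y ih =>
    -- Well-foundedness of the converse provides an immediate predecessor. Without it `y` could be a
    -- limit, to which `height` assigns the default value 0.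
    obtain ⟨z, hz, hmax⟩ := hwf'.has_min {z | lt z y} ⟨x, h⟩
    have hzy : ImmPred lt z y := ⟨hz, fun w hw => hmax w hw⟩
    rw [height_of_immPred hwf htot hzy, Nat.lt_succ_iff]
    by_cases hxz : lt x z
    · exact (ih z hz hxz).le
    · exact (height_eq_of_incomparable hwf htot (not_or.2 ⟨hxz, hmax x h⟩)).le

end Height

/-- `Nat.pair` runs through the shells `max a b = s`: up the column `b = s`, then along the row `a =
s`. The cases are a step in the first stretch, the passage to the second, a step in the second, and
the passage to the next shell. -/
theorem Nat.pair_succ_of_step {a b a' b' : ℕ}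
    (h : a = a' + 1 ∧ a < b ∧ b' = b ∨ b' = a' + 1 ∧ b' = a ∧ b = 0 ∨
      b' < a' ∧ a' = a ∧ b = b' + 1 ∨ a' = b' ∧ a = 0 ∧ b = b' + 1) :
    Nat.pair a b = Nat.pair a' b' + 1 := by
  rcases h with ⟨rfl, h, rfl⟩ | ⟨rfl, rfl, rfl⟩ | ⟨h, rfl, rfl⟩ | ⟨rfl, rfl, rfl⟩
  · rw [Nat.pair, Nat.pair, if_pos h, if_pos (by omega)]; ring
  · rw [Nat.pair, Nat.pair, if_neg (by omega), if_pos (by omega)]; ring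
  · rw [Nat.pair, Nat.pair, if_neg (by omega), if_neg (by omega)]; ring
  · rw [Nat.pair, Nat.pair, if_pos (by omega), if_neg (by omega)]; ring

namespace Nat.Partrec.Code

theorem mem_eval_pair {f g : Code} {x y : ℕ} :
    y ∈ (Code.pair f g).eval x ↔ ∃ y₁ ∈ f.eval x, ∃ y₂ ∈ g.eval x, Nat.pair y₁ y₂ = y := by
  simp [Code.eval, Seq.seq]

theorem mem_eval_rfind' {f : Code} {a m y : ℕ} :
    y ∈ (Code.rfind' f).eval (Nat.pair a m) ↔ m ≤ y ∧ 0 ∈ f.eval (Nat.pair a y) ∧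
      ∀ k, m ≤ k → k < y → ∃ z, z + 1 ∈ f.eval (Nat.pair a k) := by
  simp only [Code.eval, Nat.unpaired, Nat.unpair_pair]
  rw [Part.mem_map_iff]
  constructor
  · rintro ⟨n, hn, rfl⟩
    obtain ⟨hn, h⟩ := Nat.mem_rfind.1 hn
    obtain ⟨z, hz, hz'⟩ := (Part.mem_map_iff _).1 hn
    refine ⟨Nat.le_add_left _ _, ?_, fun k h₁ h₂ => ?_⟩
    · rwa [of_decide_eq_true hz'] at hz
    · obtain ⟨j, rfl⟩ := Nat.exists_eq_add_of_le' h₁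
      obtain ⟨z, hz, hz'⟩ := (Part.mem_map_iff _).1 (h (Nat.lt_of_add_lt_add_right h₂))
      exact ⟨z - 1, by rwa [Nat.sub_add_cancel (Nat.pos_of_ne_zero (of_decide_eq_false hz'))]⟩
  · rintro ⟨h₁, h₂, h₃⟩
    obtain ⟨n, rfl⟩ := Nat.exists_eq_add_of_le' h₁
    refine ⟨n, Nat.mem_rfind.2 ⟨(Part.mem_map_iff _).2 ⟨0, h₂, rfl⟩, fun {k} hk => ?_⟩, rfl⟩
    obtain ⟨z, hz⟩ := h₃ (k + m) (Nat.le_add_left _ _) (by omega)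
    exact (Part.mem_map_iff _).2 ⟨z + 1, hz, rfl⟩

end Nat.Partrec.Code

/-! ### Soundness: the letters describe true facts about heights -/

namespace SchemaFormula

theorem evalAxiom_mem_evalAxioms (c : Code) : evalAxiom c ∈ evalAxioms c := by
  cases c <;> simp [evalAxioms]

variable {α : Type*} {R : ℕ → List α → Prop} {w : Fin 0 → α}

theorem height_pair (hwf : WellFounded fun x y => R 0 [x, y])
    (hwf' : WellFounded fun x y => R 0 [y, x]) (h : ∀ φ ∈ orderAxioms, φ.Realize R w)
    {p a b : α} (hp : R 0 [p, a, b]) :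
    height hwf p = Nat.pair (height hwf a) (height hwf b) := by
  obtain ⟨-, -, htot, hS, hS', hE, hZ, hP⟩ := realize_orderAxioms.1 h
  have hlt {x y : α} (h : R 0 [x, y]) := height_lt hwf hwf' htot h
  have hsucc {x y : α} (h : R 1 [x, y]) := height_of_immPred hwf htot ⟨hS _ _ h, (hS' _ _ · h)⟩
  have heq {x y : α} (h : R 2 [x, y]) := height_eq_of_incomparable hwf htot (hE _ _ h)
  have hzero {x : α} (h : R 0 [x]) := height_eq_zero hwf (hZ _ · h)
  induction p using hwf.induction generalizing a b with
  | _ p ih =>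
    obtain ⟨h₁, h₂, h₃⟩ | ⟨p', a', b', h₁, h₂, h₃⟩ := hP p a b hp
    · rw [hzero h₁, hzero h₂, hzero h₃]; rfl
    · rw [hsucc h₁, ih p' (hS _ _ h₁) h₂]
      symm
      apply Nat.pair_succ_of_step
      obtain ⟨h₁, h₂, h₃⟩ | ⟨h₁, h₂, h₃⟩ | ⟨h₁, h₂, h₃⟩ | ⟨h₁, h₂, h₃⟩ := h₃
      · exact .inl ⟨hsucc h₁, hlt h₂, heq h₃⟩
      · exact .inr (.inl ⟨hsucc h₁, heq h₂, hzero h₃⟩)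
      · exact .inr (.inr (.inl ⟨hlt h₁, heq h₂, hsucc h₃⟩))
      · exact .inr (.inr (.inr ⟨heq h₁, hzero h₂, hsucc h₃⟩))

theorem height_mem_eval (hwf : WellFounded fun x y => R 0 [x, y])
    (hwf' : WellFounded fun x y => R 0 [y, x]) (h : ∀ φ ∈ orderAxioms, φ.Realize R w)
    {c : Code} (hc : ∀ φ ∈ evalAxioms c, φ.Realize R w) {x y : α}
    (hxy : R (evalIndex c) [x, y]) : height hwf y ∈ c.eval (height hwf x) := by
  have hpair {p a b : α} (hp : R 0 [p, a, b]) := height_pair hwf hwf' h hp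
  obtain ⟨-, -, htot, hS, hS', hE, hZ, -⟩ := realize_orderAxioms.1 h
  have hsucc {x y : α} (h : R 1 [x, y]) := height_of_immPred hwf htot ⟨hS _ _ h, (hS' _ _ · h)⟩
  have heq {x y : α} (h : R 2 [x, y]) := height_eq_of_incomparable hwf htot (hE _ _ h)
  have hzero {x : α} (h : R 0 [x]) := height_eq_zero hwf (hZ _ · h)
  induction c generalizing x y with
  | zero =>
    have := realize_evalAxiom_zero.1 (hc _ (evalAxiom_mem_evalAxioms _)) _ _ hxy
    rw [hzero this]
    exact Part.mem_some _
  | succ =>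
    have := realize_evalAxiom_succ.1 (hc _ (evalAxiom_mem_evalAxioms _)) _ _ hxy
    rw [hsucc this]
    exact Part.mem_some _
  | left =>
    obtain ⟨b, hb⟩ := realize_evalAxiom_left.1 (hc _ (evalAxiom_mem_evalAxioms _)) _ _ hxy
    rw [hpair hb]
    simp [Code.eval]
  | right =>
    obtain ⟨b, hb⟩ := realize_evalAxiom_right.1 (hc _ (evalAxiom_mem_evalAxioms _)) _ _ hxy
    rw [hpair hb]
    simp [Code.eval]
  | pair f g ihf ihg =>
    obtain ⟨y₁, y₂, h₁, h₂, h₃⟩ :=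
      realize_evalAxiom_pair.1 (hc _ (evalAxiom_mem_evalAxioms _)) _ _ hxy
    have h₁ := ihf (fun φ hφ => hc φ (by simp [evalAxioms, hφ])) h₁
    have h₂ := ihg (fun φ hφ => hc φ (by simp [evalAxioms, hφ])) h₂
    rw [hpair h₃]
    exact (Code.mem_eval_pair).2 ⟨_, h₁, _, h₂, rfl⟩
  | comp f g ihf ihg =>
    obtain ⟨z, h₁, h₂⟩ := realize_evalAxiom_comp.1 (hc _ (evalAxiom_mem_evalAxioms _)) _ _ hxy
    have h₁ := ihg (fun φ hφ => hc φ (by simp [evalAxioms, hφ])) h₁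
    have h₂ := ihf (fun φ hφ => hc φ (by simp [evalAxioms, hφ])) h₂
    exact Part.mem_bind h₁ h₂
  | prec f g ihf ihg =>
    have ax := realize_evalAxiom_prec.1 (hc _ (evalAxiom_mem_evalAxioms _))
    have ihf {x y} := @ihf (fun φ hφ => hc φ (by simp [evalAxioms, hφ])) x y
    have ihg {x y} := @ihg (fun φ hφ => hc φ (by simp [evalAxioms, hφ])) x y
    -- The recursion is on the numerical counter coded by `x`; the elements of the model
    -- representing this counter are not unique.
    generalize hk : (height hwf x).unpair.2 = k
    induction k generalizing x y with
    | zero =>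
      obtain ⟨a, m, hx, ⟨hm, hf⟩ | ⟨m', x', i, t, s, h₁, h₂, h₃, h₄, h₅, h₆⟩⟩ := ax x y hxy
      · rw [hpair hx, hzero hm, Code.eval_prec_zero]
        exact ihf hf
      · rw [hpair hx, Nat.unpair_pair, hsucc h₁] at hk
        cases hk
    | succ k ih =>
      obtain ⟨a, m, hx, ⟨hm, hf⟩ | ⟨m', x', i, t, s, h₁, h₂, h₃, h₄, h₅, h₆⟩⟩ := ax x y hxy
      · rw [hpair hx, Nat.unpair_pair, hzero hm] at hk
        cases hk
      · rw [hpair hx, Nat.unpair_pair, hsucc h₁] at hk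
        have hi := ih h₃ (by rw [hpair h₂, Nat.unpair_pair]; exact Nat.succ_injective hk)
        have hg := ihg h₆
        rw [hpair h₂] at hi
        rw [hpair h₅, hpair h₄] at hg
        rw [hpair hx, hsucc h₁, Code.eval_prec_succ]
        exact Part.mem_bind hi hg
  | rfind' f ihf =>
    have ax := realize_evalAxiom_rfind'.1 (hc _ (evalAxiom_mem_evalAxioms _))
    have ihf {x y} := @ihf (fun φ hφ => hc φ (by simp [evalAxioms, hφ])) x y
    have key (m : α) : ∀ a x y, R 0 [x, a, m] → R (evalIndex (.rfind' f)) [x, y] →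
        height hwf y ∈ (Code.rfind' f).eval (height hwf x) := by
      -- The search moves upward, so its termination rests on the absence of ascending chains.
      induction m using hwf'.induction with
      | _ m ih =>
        intro a x y hx hxy
        obtain ⟨a', m₁, z, hx', hz, ⟨hz0, hm⟩ | ⟨u, m', x', h₁, h₂, h₃, h₄⟩⟩ := ax x y hxy
        all_goals
          obtain ⟨ha, hm₁⟩ := Nat.pair_eq_pair.1 ((hpair hx).symm.trans (hpair hx'))
          have hz := ihf hz
          rw [hpair hx] at hz ⊢
        · rw [hzero hz0] at hz
          rw [Code.mem_eval_rfind', ← heq hm, ← hm₁]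
          exact ⟨le_rfl, hz, fun k h₁ h₂ => absurd h₁ h₂.not_ge⟩
        -- `m'` succeeds `m₁`, which only has the same height as `m`. The weak order and the
        -- strictness of heights still put `m` below `m'`.
        · have hmm' : R 0 [m, m'] := (htot m₁ m' m (hS _ _ h₂)).resolve_left fun h' =>
            (height_lt hwf hwf' htot h').ne hm₁.symm
          have := ih m' hmm' a' x' y h₃ h₄
          rw [hpair h₃, hsucc h₂, ← ha, ← hm₁, Code.mem_eval_rfind'] at this
          rw [hsucc h₁] at hz
          rw [Code.mem_eval_rfind']
          refine ⟨by omega, this.2.1, fun k hk hk' => ?_⟩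
          obtain rfl | hk := hk.eq_or_lt
          · exact ⟨_, hz⟩
          · exact this.2.2 k hk hk'
    obtain ⟨a, m, z, h₁, -⟩ := ax x y hxy
    exact key m a x y h₁ hxy

theorem dom_of_realize_computation (hwf : WellFounded fun x y => R 0 [x, y])
    (hwf' : WellFounded fun x y => R 0 [y, x]) {c : Code} {e : ℕ}
    (h : (computation c e).Realize R w) : (c.eval e).Dom := by
  simp only [computation, realize_conj, realize_conjList, List.mem_append, or_imp,
    forall_and, realize_numeralAxioms, realize_haltsAt] at h
  obtain ⟨⟨ho, hc⟩, hn, x, y, hx, hxy⟩ := h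
  obtain ⟨-, -, htot, hS, hS', -, hZ, -⟩ := realize_orderAxioms.1 ho
  have hnum : ∀ i ≤ e, ∀ x, R i [x] → height hwf x = i := by
    intro i
    induction i with
    | zero => exact fun _ x hx => height_eq_zero hwf (hZ _ · hx)
    | succ i ih =>
      intro hi y hy
      obtain ⟨x, hx, hxy⟩ := hn i hi y hy
      rw [height_of_immPred hwf htot ⟨hS _ _ hxy, (hS' _ _ · hxy)⟩, ih (by omega) x hx]
  have := height_mem_eval hwf hwf' ho hc hxy
  rw [hnum e le_rfl x hx] at this
  exact Part.dom_iff_mem.2 ⟨_, this⟩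

end SchemaFormula

/-! ### Completeness: halting computations have finite models -/

/-- `EvalBelow K c x y` means that the function with code `c` takes the value `y` at `x` by a
computation in which only numbers below `K` occur. -/
inductive EvalBelow (K : ℕ) : Code → ℕ → ℕ → Prop
  | zero {x : ℕ} : x < K → EvalBelow K .zero x 0
  | succ {x : ℕ} : x + 1 < K → EvalBelow K .succ x (x + 1)
  | left {a b : ℕ} : Nat.pair a b < K → EvalBelow K .left (Nat.pair a b) a
  | right {a b : ℕ} : Nat.pair a b < K → EvalBelow K .right (Nat.pair a b) b
  | pair {f g : Code} {x y₁ y₂ : ℕ} : EvalBelow K f x y₁ → EvalBelow K g x y₂ →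
      Nat.pair y₁ y₂ < K → EvalBelow K (.pair f g) x (Nat.pair y₁ y₂)
  | comp {f g : Code} {x y z : ℕ} : EvalBelow K g x z → EvalBelow K f z y →
      EvalBelow K (.comp f g) x y
  | prec_zero {f g : Code} {a y : ℕ} : Nat.pair a 0 < K → EvalBelow K f a y →
      EvalBelow K (.prec f g) (Nat.pair a 0) y
  | prec_succ {f g : Code} {a m i y : ℕ} : Nat.pair a (m + 1) < K →
      EvalBelow K (.prec f g) (Nat.pair a m) i → EvalBelow K g (Nat.pair a (Nat.pair m i)) y →
      EvalBelow K (.prec f g) (Nat.pair a (m + 1)) y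
  | rfind_zero {f : Code} {a m : ℕ} : EvalBelow K f (Nat.pair a m) 0 →
      EvalBelow K (.rfind' f) (Nat.pair a m) m
  | rfind_succ {f : Code} {a m z y : ℕ} : EvalBelow K f (Nat.pair a m) (z + 1) →
      EvalBelow K (.rfind' f) (Nat.pair a (m + 1)) y → EvalBelow K (.rfind' f) (Nat.pair a m) y

namespace EvalBelow

theorem lt {K : ℕ} {c : Code} {x y : ℕ} (h : EvalBelow K c x y) : x < K ∧ y < K := by
  induction h with
  | zero h => exact ⟨h, by omega⟩
  | succ h => omega
  | left h => exact ⟨h, (Nat.left_le_pair _ _).trans_lt h⟩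
  | right h => exact ⟨h, (Nat.right_le_pair _ _).trans_lt h⟩
  | pair _ _ h ih₁ => exact ⟨ih₁.1, h⟩
  | comp _ _ ih₁ ih₂ => exact ⟨ih₁.1, ih₂.2⟩
  | prec_zero h _ ih => exact ⟨h, ih.2⟩
  | prec_succ h _ _ _ ih => exact ⟨h, ih.2⟩
  | rfind_zero _ ih => exact ⟨ih.1, (Nat.right_le_pair _ _).trans_lt ih.1⟩
  | rfind_succ _ _ ih₁ ih₂ => exact ⟨ih₁.1, ih₂.2⟩

theorem mono {K K' : ℕ} (hK : K ≤ K') {c : Code} {x y : ℕ} (h : EvalBelow K c x y) :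
    EvalBelow K' c x y := by
  induction h with
  | zero h => exact .zero (h.trans_le hK)
  | succ h => exact .succ (h.trans_le hK)
  | left h => exact .left (h.trans_le hK)
  | right h => exact .right (h.trans_le hK)
  | pair _ _ h ih₁ ih₂ => exact .pair ih₁ ih₂ (h.trans_le hK)
  | comp _ _ ih₁ ih₂ => exact .comp ih₁ ih₂
  | prec_zero h _ ih => exact .prec_zero (h.trans_le hK) ih
  | prec_succ h _ _ ih₁ ih₂ => exact .prec_succ (h.trans_le hK) ih₁ ih₂
  | rfind_zero _ ih => exact .rfind_zero ih
  | rfind_succ _ _ ih₁ ih₂ => exact .rfind_succ ih₁ ih₂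

theorem exists_of_mem_eval {c : Code} {x y : ℕ} (h : y ∈ c.eval x) :
    ∃ K, EvalBelow K c x y := by
  induction c generalizing x y with
  | zero =>
    obtain rfl : y = 0 := by simpa [Code.eval, pure, PFun.pure] using h
    exact ⟨x + 1, .zero (Nat.lt_succ_self _)⟩
  | succ =>
    obtain rfl : y = x + 1 := by simpa [Code.eval] using h
    exact ⟨x + 2, .succ (Nat.lt_succ_self _)⟩
  | left =>
    obtain rfl : y = x.unpair.1 := by simpa [Code.eval] using h
    obtain ⟨a, b, rfl⟩ : ∃ a b, x = Nat.pair a b := ⟨_, _, (Nat.pair_unpair x).symm⟩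
    simp only [Nat.unpair_pair]
    exact ⟨_, .left (Nat.lt_succ_self _)⟩
  | right =>
    obtain rfl : y = x.unpair.2 := by simpa [Code.eval] using h
    obtain ⟨a, b, rfl⟩ : ∃ a b, x = Nat.pair a b := ⟨_, _, (Nat.pair_unpair x).symm⟩
    simp only [Nat.unpair_pair]
    exact ⟨_, .right (Nat.lt_succ_self _)⟩
  | pair f g ihf ihg =>
    obtain ⟨y₁, h₁, y₂, h₂, rfl⟩ := Code.mem_eval_pair.1 h
    obtain ⟨K₁, h₁⟩ := ihf h₁
    obtain ⟨K₂, h₂⟩ := ihg h₂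
    exact ⟨K₁ + K₂ + Nat.pair y₁ y₂ + 1, .pair (h₁.mono (by omega)) (h₂.mono (by omega))
      (by omega)⟩
  | comp f g ihf ihg =>
    obtain ⟨z, h₁, h₂⟩ := Part.mem_bind_iff.1 h
    obtain ⟨K₁, h₁⟩ := ihg h₁
    obtain ⟨K₂, h₂⟩ := ihf h₂
    exact ⟨K₁ + K₂, .comp (h₁.mono (by omega)) (h₂.mono (by omega))⟩
  | prec f g ihf ihg =>
    obtain ⟨a, m, rfl⟩ : ∃ a b, x = Nat.pair a b := ⟨_, _, (Nat.pair_unpair x).symm⟩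
    induction m generalizing y with
    | zero =>
      rw [Code.eval_prec_zero] at h
      obtain ⟨K, h⟩ := ihf h
      exact ⟨K + Nat.pair a 0 + 1, .prec_zero (by omega) (h.mono (by omega))⟩
    | succ m ih =>
      rw [Code.eval_prec_succ] at h
      obtain ⟨i, h₁, h₂⟩ := Part.mem_bind_iff.1 h
      obtain ⟨K₁, h₁⟩ := ih h₁
      obtain ⟨K₂, h₂⟩ := ihg h₂
      exact ⟨K₁ + K₂ + Nat.pair a (m + 1) + 1, .prec_succ (by omega) (h₁.mono (by omega))
        (h₂.mono (by omega))⟩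
  | rfind' f ihf =>
    obtain ⟨a, m, rfl⟩ : ∃ a b, x = Nat.pair a b := ⟨_, _, (Nat.pair_unpair x).symm⟩
    obtain ⟨hm, h₀, h₁⟩ := Code.mem_eval_rfind'.1 h
    clear h
    -- The derivation is built downward from the root `y` to the starting point of the search.
    induction hm using Nat.decreasingInduction with
    | self =>
      obtain ⟨K, h⟩ := ihf h₀
      exact ⟨K, .rfind_zero h⟩
    | of_succ m hm ih =>
      obtain ⟨K₁, h₂⟩ := ih fun k hk => h₁ k (by omega)
      obtain ⟨z, hz⟩ := h₁ m le_rfl hm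
      obtain ⟨K₂, h₃⟩ := ihf hz
      exact ⟨K₁ + K₂, .rfind_succ (h₃.mono (by omega)) (h₂.mono (by omega))⟩

end EvalBelow

namespace SchemaFormula

/-- The intended interpretation of the letters on the numbers below `K`. -/
def stdRel (K : ℕ) : ℕ → List (Fin K) → Prop
  | i, [a] => (a : ℕ) = i
  | 0, [a, b] => a < b
  | 1, [a, b] => (b : ℕ) = a + 1
  | 2, [a, b] => a = b
  | i + 3, [a, b] => EvalBelow K (Code.ofNatCode i) a b
  | 0, [p, a, b] => (p : ℕ) = Nat.pair a b
  | _, _ => False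

theorem stdRel_evalIndex {K : ℕ} {c : Code} {a b : Fin K} :
    stdRel K (evalIndex c) [a, b] ↔ EvalBelow K c a b := by
  rw [evalIndex, stdRel, ← Code.encodeCode_eq, ← Code.ofNatCode_eq, Denumerable.ofNat_encode]

/-- Every pair except `(0, 0)` has a predecessor in the enumeration by `Nat.pair`; this supplies the
witnesses for the pairing axiom. -/
theorem exists_pair_step (a b : ℕ) : a = 0 ∧ b = 0 ∨ ∃ a' b',
    a = a' + 1 ∧ a < b ∧ b' = b ∨ b' = a' + 1 ∧ b' = a ∧ b = 0 ∨
      b' < a' ∧ a' = a ∧ b = b' + 1 ∨ a' = b' ∧ a = 0 ∧ b = b' + 1 := by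
  rcases a with _ | a
  · rcases b with _ | b
    · simp
    · exact .inr ⟨b, b, by omega⟩
  · rcases lt_or_ge (a + 1) b with h | h
    · exact .inr ⟨a, b, by omega⟩
    · rcases b with _ | b
      · exact .inr ⟨a, a + 1, by omega⟩
      · exact .inr ⟨a + 1, b, by omega⟩

variable {K : ℕ} {w : Fin 0 → Fin K}

theorem realize_orderAxioms_stdRel : ∀ φ ∈ orderAxioms, φ.Realize (stdRel K) w := by
  refine realize_orderAxioms.2 ⟨?_, ?_, ?_, ?_, ?_, ?_, ?_, ?_⟩
  all_goals simp only [stdRel]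
  · exact fun x => lt_irrefl x
  · exact fun _ _ _ => lt_trans
  · exact fun x y z h => lt_or_ge x z |>.imp id h.trans_le'
  · intros; omega
  · intros; omega
  · intros; omega
  · intros; omega
  · intro p a b hp
    obtain ⟨h₁, h₂⟩ | ⟨a', b', h⟩ := exists_pair_step a b
    · exact .inl ⟨by rw [hp, h₁, h₂]; rfl, h₁, h₂⟩
    · have hs := Nat.pair_succ_of_step h
      have hlt : Nat.pair a' b' < K := by omega
      refine .inr ⟨⟨_, hlt⟩, ⟨a', (Nat.left_le_pair _ _).trans_lt hlt⟩,
        ⟨b', (Nat.right_le_pair _ _).trans_lt hlt⟩, hp.trans hs, rfl, ?_⟩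
      simpa only [Fin.lt_def, Fin.ext_iff] using h

theorem realize_evalAxiom_stdRel (c : Code) : (evalAxiom c).Realize (stdRel K) w := by
  cases c with
  | zero =>
    refine realize_evalAxiom_zero.2 fun x y h => ?_
    rw [stdRel_evalIndex] at h
    generalize hy : (y : ℕ) = y' at h
    cases h
    exact hy
  | succ =>
    refine realize_evalAxiom_succ.2 fun x y h => ?_
    rw [stdRel_evalIndex] at h
    generalize hy : (y : ℕ) = y' at h
    cases h
    exact hy
  | left =>
    refine realize_evalAxiom_left.2 fun x y h => ?_
    rw [stdRel_evalIndex] at h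
    generalize hx : (x : ℕ) = x', hy : (y : ℕ) = y' at h
    cases h with
    | @left a b h =>
      exact ⟨⟨b, (Nat.right_le_pair _ _).trans_lt h⟩, by simp [stdRel, hx, hy]⟩
  | right =>
    refine realize_evalAxiom_right.2 fun x y h => ?_
    rw [stdRel_evalIndex] at h
    generalize hx : (x : ℕ) = x', hy : (y : ℕ) = y' at h
    cases h with
    | @right a b h =>
      exact ⟨⟨a, (Nat.left_le_pair _ _).trans_lt h⟩, by simp [stdRel, hx, hy]⟩
  | pair f g =>
    refine realize_evalAxiom_pair.2 fun x y h => ?_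
    simp only [stdRel_evalIndex] at h ⊢
    generalize hx : (x : ℕ) = x', hy : (y : ℕ) = y' at h
    cases h with
    | pair h₁ h₂ h => exact ⟨⟨_, h₁.lt.2⟩, ⟨_, h₂.lt.2⟩, h₁, h₂, hy⟩
  | comp f g =>
    refine realize_evalAxiom_comp.2 fun x y h => ?_
    simp only [stdRel_evalIndex] at h ⊢
    cases h with
    | comp h₁ h₂ => exact ⟨⟨_, h₁.lt.2⟩, h₁, h₂⟩
  | prec f g =>
    refine realize_evalAxiom_prec.2 fun x y h => ?_
    simp only [stdRel_evalIndex] at h ⊢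
    generalize hx : (x : ℕ) = x' at h
    have hxlt := h.lt.1
    cases h with
    | @prec_zero _ _ a _ h₁ h₂ =>
      exact ⟨⟨a, h₂.lt.1⟩, ⟨0, by omega⟩, hx, .inl ⟨rfl, h₂⟩⟩
    | @prec_succ _ _ a m i _ h₁ h₂ h₃ =>
      have ha := (Nat.left_le_pair _ _).trans_lt h₁
      have hm := (Nat.right_le_pair _ _).trans_lt h₁
      exact ⟨⟨a, ha⟩, ⟨m + 1, hm⟩, hx, .inr ⟨⟨m, (Nat.lt_succ_self m).trans hm⟩, ⟨_, h₂.lt.1⟩,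
        ⟨_, h₂.lt.2⟩, ⟨_, (Nat.right_le_pair _ _).trans_lt h₃.lt.1⟩, ⟨_, h₃.lt.1⟩, rfl, rfl, h₂,
        rfl, rfl, h₃⟩⟩
  | rfind' f =>
    refine realize_evalAxiom_rfind'.2 fun x y h => ?_
    simp only [stdRel_evalIndex] at h ⊢
    generalize hx : (x : ℕ) = x', hy : (y : ℕ) = y' at h ⊢
    have hxlt := h.lt.1
    cases h with
    | @rfind_zero _ a m h =>
      exact ⟨⟨a, (Nat.left_le_pair _ _).trans_lt hxlt⟩, ⟨_, (Nat.right_le_pair _ _).trans_lt hxlt⟩,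
        ⟨0, h.lt.2⟩, hx, h, .inl ⟨rfl, Fin.ext hy.symm⟩⟩
    | @rfind_succ _ a m z _ h₁ h₂ =>
      exact ⟨⟨a, (Nat.left_le_pair _ _).trans_lt hxlt⟩, ⟨_, (Nat.right_le_pair _ _).trans_lt hxlt⟩,
        ⟨_, h₁.lt.2⟩, hx, h₁, .inr ⟨⟨z, (Nat.lt_succ_self z).trans h₁.lt.2⟩,
        ⟨m + 1, (Nat.right_le_pair _ _).trans_lt h₂.lt.1⟩, ⟨_, h₂.lt.1⟩, rfl, rfl, rfl, h₂⟩⟩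

theorem realize_of_mem_evalAxioms {R : ℕ → List (Fin K) → Prop}
    (h : ∀ c, (evalAxiom c).Realize R w) (c : Code) : ∀ φ ∈ evalAxioms c, φ.Realize R w := by
  induction c <;> simp_all [evalAxioms, or_imp]

theorem exists_realize_computation_of_dom {c : Code} {e : ℕ} (h : (c.eval e).Dom) :
    ∃ K, 0 < K ∧ ∀ w : Fin 0 → Fin K, (computation c e).Realize (stdRel K) w := by
  obtain ⟨y, hy⟩ := Part.dom_iff_mem.1 h
  obtain ⟨K, hK⟩ := EvalBelow.exists_of_mem_eval hy
  refine ⟨K, by have := hK.lt; omega, fun w => ?_⟩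
  simp only [computation, realize_conj, realize_conjList, List.mem_append, or_imp, forall_and,
    realize_numeralAxioms, realize_haltsAt]
  refine ⟨⟨realize_orderAxioms_stdRel, realize_of_mem_evalAxioms realize_evalAxiom_stdRel c⟩,
    fun i hi y hy => ⟨⟨i, ?_⟩, rfl, hy⟩, ⟨e, hK.lt.1⟩, ⟨y, hK.lt.2⟩, rfl, stdRel_evalIndex.2 hK⟩
  exact hi.trans hK.lt.1

end SchemaFormula

/-! ### Blocks of variables: from elements to tuples -/

/-- The `k`-th entry of the `j`-th block of length `n`. -/
def blockIndex {n m : ℕ} (j : Fin m) (k : Fin n) : Fin (n * m) :=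
  ⟨n * j + k, Nat.mul_comm m n ▸ Nat.mul_add_lt_mul_of_lt_of_lt j.2 k.2⟩

theorem exists_blockIndex {n m : ℕ} (i : Fin (n * m)) :
    ∃ (j : Fin m) (k : Fin n), blockIndex j k = i := by
  have hn : 0 < n := Nat.pos_of_mul_pos_right (Nat.zero_lt_of_lt i.2)
  exact ⟨⟨i / n, Nat.div_lt_of_lt_mul i.2⟩, ⟨i % n, Nat.mod_lt _ hn⟩,
    Fin.ext (Nat.div_add_mod _ _)⟩

theorem List.ofFn_blocks {α : Type*} {n m : ℕ} (f : Fin (n * m) → α) :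
    List.ofFn f = (List.ofFn fun j k => f (blockIndex j k)).flatMap List.ofFn := by
  rw [List.ofFn_mul', List.flatMap, List.map_ofFn]
  rfl

/-- Equality of lengths must be assumed because of `n = 0`, where all blocks are empty. -/
theorem List.flatMap_ofFn_injective {α : Type*} {n : ℕ} {l l' : List (Fin n → α)}
    (hlen : l.length = l'.length) (h : l.flatMap List.ofFn = l'.flatMap List.ofFn) : l = l' := by
  refine List.map_injective_iff.2 (List.ofFn_injective (n := n)) (List.eq_iff_flatten_eq.2 ⟨h, ?_⟩)
  simp [Function.comp_def, hlen]

namespace SchemaFormula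

/-- A block of `k` universal quantifiers. -/
def allBlock : (k : ℕ) → {m : ℕ} → SchemaFormula (m + k) → SchemaFormula m
  | 0, _, φ => φ
  | k + 1, _, φ => allBlock k φ.all

/-- The formula about `n`-tuples that corresponds to a formula about elements: every variable is
replaced by a block of `n` variables. -/
noncomputable def tupled (n : ℕ) : {m : ℕ} → SchemaFormula m → SchemaFormula (n * m)
  | _, falsum => falsum
  | _, rel r i x => rel (n * r) i fun j => blockIndex (x (exists_blockIndex j).choose)
      (exists_blockIndex j).choose_spec.choose
  | _, imp φ ψ => (tupled n φ).imp (tupled n ψ)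
  | _, all φ => allBlock n (tupled n φ)

/-- The relations between `n`-tuples induced by relations between elements. -/
def tupledRel {α : Type*} (n : ℕ) (R : ℕ → List α → Prop) (i : ℕ) (l : List (Fin n → α)) : Prop :=
  R i (l.flatMap List.ofFn)

theorem blockIndex_inj {n m : ℕ} {j j' : Fin m} {k k' : Fin n}
    (h : blockIndex j k = blockIndex j' k') : j = j' ∧ k = k' := by
  have h : n * j + k = n * j' + k' := congrArg Fin.val h
  have h₁ := congrArg (· / n) h
  have h₂ := congrArg (· % n) h
  have hn : 0 < n := Nat.zero_lt_of_lt k.2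
  simp only [Nat.mul_add_div hn, Nat.mul_add_mod, Nat.div_eq_of_lt k.2, Nat.div_eq_of_lt k'.2,
    Nat.mod_eq_of_lt k.2, Nat.mod_eq_of_lt k'.2] at h₁ h₂
  exact ⟨Fin.ext (by simpa using h₁), Fin.ext h₂⟩

section

variable {α : Type*} {R : ℕ → List α → Prop}

theorem realize_allBlock {k m : ℕ} {φ : SchemaFormula (m + k)} {w : Fin m → α} :
    (allBlock k φ).Realize R w ↔ ∀ a : Fin k → α, φ.Realize R (Fin.append w a) := by
  induction k with
  | zero =>
    rw [allBlock]
    refine ⟨fun h a => ?_, fun h => ?_⟩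
    · rwa [Fin.append_right_nil _ _ rfl]
    · simpa [Fin.append_right_nil] using h Fin.elim0
  | succ k ih =>
    rw [allBlock, ih]
    refine ⟨fun h a => ?_, fun h a b => ?_⟩
    · have := h (Fin.init a) (a (Fin.last k))
      rwa [← Fin.append_snoc, Fin.snoc_init_self] at this
    · rw [← Fin.append_snoc]
      exact h _

theorem realize_tupled {n m : ℕ} {φ : SchemaFormula m} {w : Fin (n * m) → α} :
    (tupled n φ).Realize R w ↔
      φ.Realize (tupledRel n R) fun j k => w (blockIndex j k) := by
  induction φ with
  | falsum => exact Iff.rfl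
  | rel r i x =>
    simp only [tupled, Realize, tupledRel]
    rw [List.ofFn_blocks]
    refine iff_of_eq (congrArg (fun f => R i ((List.ofFn f).flatMap List.ofFn)) ?_)
    funext j k
    -- The decomposition into block and offset is unique, so the choices made in `tupled` are the
    -- expected ones.
    have h := blockIndex_inj (exists_blockIndex (blockIndex j k)).choose_spec.choose_spec
    rw [h.2, h.1]
  | imp φ ψ ih₁ ih₂ => simp only [tupled, realize_imp, ih₁, ih₂]
  | @all m φ ih =>
    rw [tupled, realize_allBlock, realize_all]
    refine forall_congr' fun a => ih.trans (iff_of_eq (congrArg _ ?_))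
    funext j k
    refine Fin.lastCases ?_ (fun j => ?_) j
    · rw [Fin.snoc_last]
      exact Fin.append_right w a k
    · rw [Fin.snoc_castSucc]
      exact Fin.append_left w a (blockIndex j k)

/-- Injectivity is not needed because the schematic language has no identity; surjectivity takes
care of the quantifiers. -/
theorem realize_of_surjective {β : Type*} {S : ℕ → List β → Prop} {f : α → β}
    (hf : Function.Surjective f) (hR : ∀ i l, R i l ↔ S i (l.map f)) {m : ℕ} {φ : SchemaFormula m}
    {w : Fin m → α} : φ.Realize R w ↔ φ.Realize S (f ∘ w) := by
  induction φ with
  | falsum => exact Iff.rfl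
  | rel r i x =>
    simp only [Realize, hR, List.map_ofFn]
    rfl
  | imp φ ψ ih₁ ih₂ => simp only [realize_imp, ih₁, ih₂]
  | all φ ih =>
    simp only [realize_all, ih, Fin.comp_snoc, hf.forall]

end

/-! ### Primitive recursive Gödel numbers and the Turing reduction -/

/-- A family of formulas whose `n`-tupled Gödel numbers are primitive recursive, for every `n`. -/
def PrimrecTupled {m : ℕ} (φ : ℕ → SchemaFormula m) : Prop :=
  ∀ n, Primrec fun e => (tupled n (φ e)).code

theorem primrec_code_all {m : ℕ} {φ : ℕ → SchemaFormula (m + 1)}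
    (h : Primrec fun e => (φ e).code) : Primrec fun e => (φ e).all.code :=
  Primrec.nat_add.comp (Primrec.nat_mul.comp (Primrec.const 3) h) (Primrec.const 3)

theorem primrec_code_allBlock {k m : ℕ} {φ : ℕ → SchemaFormula (m + k)}
    (h : Primrec fun e => (φ e).code) : Primrec fun e => (allBlock k (φ e)).code := by
  induction k with
  | zero => exact h
  | succ k ih => exact ih (primrec_code_all h)

namespace PrimrecTupled

variable {m : ℕ}

theorem const (φ : SchemaFormula m) : PrimrecTupled fun _ => φ := fun _ => Primrec.const _

theorem rel {g : ℕ → ℕ} (hg : Primrec g) {r : ℕ} (x : Fin r → Fin m) :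
    PrimrecTupled fun e => SchemaFormula.rel r (g e) x := fun _ =>
  Primrec.nat_add.comp (Primrec.nat_mul.comp (Primrec.const 3)
    (Primrec₂.natPair.comp hg (Primrec.const _))) (Primrec.const 1)

theorem imp {φ ψ : ℕ → SchemaFormula m} (hφ : PrimrecTupled φ) (hψ : PrimrecTupled ψ) :
    PrimrecTupled fun e => (φ e).imp (ψ e) := fun n =>
  Primrec.nat_add.comp (Primrec.nat_mul.comp (Primrec.const 3)
    (Primrec₂.natPair.comp (hφ n) (hψ n))) (Primrec.const 2)

theorem all {φ : ℕ → SchemaFormula (m + 1)} (hφ : PrimrecTupled φ) :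
    PrimrecTupled fun e => (φ e).all := fun n => primrec_code_allBlock (hφ n)

theorem neg {φ : ℕ → SchemaFormula m} (hφ : PrimrecTupled φ) :
    PrimrecTupled fun e => (φ e).neg := hφ.imp (const _)

theorem conj {φ ψ : ℕ → SchemaFormula m} (hφ : PrimrecTupled φ) (hψ : PrimrecTupled ψ) :
    PrimrecTupled fun e => (φ e).conj (ψ e) := (hφ.imp hψ.neg).neg

theorem ex {φ : ℕ → SchemaFormula (m + 1)} (hφ : PrimrecTupled φ) :
    PrimrecTupled fun e => (φ e).ex := hφ.neg.all.neg

theorem numeralAxiom : PrimrecTupled SchemaFormula.numeralAxiom :=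
  ((rel Primrec.succ _).imp ((rel Primrec.id _).conj (const _)).ex).all

theorem numeralAxioms : PrimrecTupled SchemaFormula.numeralAxioms := by
  intro n
  have himp : Primrec₂ fun a b : ℕ => 3 * Nat.pair a b + 2 :=
    Primrec.nat_add.comp₂ (Primrec.nat_mul.comp₂ (Primrec₂.const 3) Primrec₂.natPair)
      (Primrec₂.const 2)
  have hneg : Primrec fun a : ℕ => 3 * Nat.pair a 0 + 2 := himp.comp .id (Primrec.const 0)
  have hconj : Primrec₂ fun a b : ℕ =>
      3 * Nat.pair (3 * Nat.pair a (3 * Nat.pair b 0 + 2) + 2) 0 + 2 :=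
    hneg.comp (himp.comp Primrec.fst (hneg.comp Primrec.snd))
  -- Tupling commutes with conjunction, so the codes themselves satisfy a primitive recursion whose
  -- step is the arithmetic of `conj`.
  refine (Primrec.nat_rec₁ (tupled n (SchemaFormula.numeralAxioms 0)).code
    (hconj.comp₂ (((numeralAxiom n).comp Primrec.fst).to₂) Primrec₂.right)).of_eq fun e => ?_
  induction e with
  | zero => rfl
  | succ e ih =>
    exact congrArg (fun b => 3 * Nat.pair (3 * Nat.pair _ (3 * Nat.pair b 0 + 2) + 2) 0 + 2) ih

/-- With `c` fixed, the order and evaluation axioms are constant; `e` enters only through the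
numerals. -/
theorem computation (c : Code) : PrimrecTupled (SchemaFormula.computation c) :=
  (const _).conj (numeralAxioms.conj ((rel Primrec.id _).conj (const _)).ex.ex)

end PrimrecTupled

end SchemaFormula

open Classical in
theorem turingReducible_charFun_of_primrec {A B : Set ℕ} {f : ℕ → ℕ} (hf : Primrec f)
    (h : ∀ e, e ∈ A ↔ f e ∉ B) : TuringReducible (charFun A) (charFun B) := by
  have h₁ : Nat.RecursiveIn {charFun B} (f : ℕ →. ℕ) :=
    (Partrec.nat_iff.1 hf.to_comp).recursiveIn
  have h₂ : Nat.RecursiveIn {charFun B} ((1 - · : ℕ → ℕ) : ℕ →. ℕ) :=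
    (Partrec.nat_iff.1 (Primrec.nat_sub.comp (Primrec.const 1) .id).to_comp).recursiveIn
  refine RecursiveIn.iff_nat.2 <| (h₂.comp ((Nat.RecursiveIn.oracle _ (Set.mem_singleton _)).comp h₁)).of_eq fun e => ?_
  have h₃ : ((Part.some (f e)).bind fun b => charFun B b).bind (fun b => Part.some (1 - b)) =
      charFun A e := by
    simp only [Part.bind_some, charFun, h]
    split_ifs <;> rfl
  exact h₃

/-- The diagonal of the universal function is itself partial recursive, so one code serves for all
`e`. -/
theorem exists_code_haltingSet : ∃ c : Code, ∀ e, e ∈ haltingSet ↔ (c.eval e).Dom := by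
  have : Partrec fun e : ℕ => (Denumerable.ofNat Code e).eval e :=
    Code.eval_part.comp (Computable.ofNat Code) Computable.id
  obtain ⟨c, hc⟩ := Code.exists_code.1 (Partrec.nat_iff.1 this)
  exact ⟨c, fun e => by rw [hc]; rfl⟩

theorem Sum.elim_comp_finSumFinEquiv_symm {α : Type*} {m n : ℕ} (a : Fin m → α) (b : Fin n → α) :
    Sum.elim a b ∘ finSumFinEquiv.symm = Fin.append a b := by
  rw [Equiv.comp_symm_eq]
  funext j
  cases j
  · exact (Fin.append_left a b _).symm
  · exact (Fin.append_right a b _).symm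

/-! ### Substitution instances in a model of `T` -/

namespace FirstOrder.Language

variable {L : Language.{u, v}}

/-- Missing variables are added through trivially true antecedents `x_i = x_i`, which meets the
demand that substituted formulas have exactly the prescribed free variables. -/
theorem Formula.exists_freeVarFinset_eq_univ (M : Type*) [L.Structure M] {n : ℕ} (φ : L.Formula (Fin n)) :
    ∃ ψ : L.Formula (Fin n), ψ.freeVarFinset = Finset.univ ∧
      ∀ x : Fin n → M, ψ.Realize x ↔ φ.Realize x := by
  suffices h : ∀ s : Finset (Fin n), ∃ ψ : L.Formula (Fin n), s ⊆ ψ.freeVarFinset ∧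
      ∀ x : Fin n → M, ψ.Realize x ↔ φ.Realize x by
    obtain ⟨ψ, hψ, h⟩ := h Finset.univ
    exact ⟨ψ, Finset.univ_subset_iff.1 hψ, h⟩
  intro s
  induction s using Finset.induction_on with
  | empty => exact ⟨φ, Finset.empty_subset _, fun _ => Iff.rfl⟩
  | insert i s _ ih =>
    obtain ⟨ψ, hψ, h⟩ := ih
    refine ⟨(Term.equal (var i) (var i)).imp ψ, ?_, fun x => ?_⟩
    · refine Finset.insert_subset ?_ (hψ.trans ?_)
      · simp [BoundedFormula.freeVarFinset, Term.equal, Term.varFinsetLeft, Term.bdEqual]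
      · exact Finset.subset_union_right
    · simp [h]

end FirstOrder.Language

variable {L : FirstOrder.Language.{u, v}}

/-- The relations on `M` defined by a substitution. -/
def substRel (M : Type*) [L.Structure M] (ψ : (n : ℕ) → ℕ → L.Formula (Fin n)) (i : ℕ)
    (l : List M) : Prop :=
  (ψ l.length i).Realize l.get

theorem substRel_ofFn {M : Type*} [L.Structure M] {ψ : (n : ℕ) → ℕ → L.Formula (Fin n)} {i n : ℕ}
    {x : Fin n → M} : substRel M ψ i (List.ofFn x) ↔ (ψ n i).Realize x := by
  obtain ⟨l, hl⟩ : ∃ l, l = List.ofFn x := ⟨_, rfl⟩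
  rw [← hl]
  have hn : l.length = n := by simp [hl]
  subst hn
  rw [substRel]
  have : l.get = x := List.ofFn_injective ((List.ofFn_get _).trans hl)
  rw [this]

theorem SchemaFormula.realize_substitute {M : Type*} [L.Structure M]
    {ψ : (n : ℕ) → ℕ → L.Formula (Fin n)} {m : ℕ} {φ : SchemaFormula m} {e : Empty → M}
    {w : Fin m → M} : (φ.substitute ψ).Realize e w ↔ φ.Realize (substRel M ψ) w := by
  induction φ with
  | falsum => exact Iff.rfl
  | rel n i x =>
    rw [SchemaFormula.Realize, substRel_ofFn, substitute, BoundedFormula.realize_relabel,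
      Formula.Realize]
    refine iff_of_eq (congrArg₂ _ rfl (Subsingleton.elim _ _))
  | imp φ χ ih₁ ih₂ => simp only [substitute, BoundedFormula.realize_imp, ih₁, ih₂, realize_imp]
  | all φ ih => simp only [substitute, BoundedFormula.realize_all, ih, realize_all]

theorem mem_iff_realize {T : L.Theory} (hclosed : ClosedUnderConsequence T)
    (hcomplete : T.IsComplete) (M : Theory.ModelType.{u, v, max u v} T) (σ : L.Sentence) :
    σ ∈ T ↔ M ⊨ σ :=
  ⟨fun h => Theory.realize_sentence_of_mem T h,
    fun h => hclosed σ ((hcomplete.realize_sentence_iff σ M).1 h)⟩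

theorem mem_validities_iff {T : L.Theory} (hclosed : ClosedUnderConsequence T)
    (hcomplete : T.IsComplete) (M : Theory.ModelType.{u, v, max u v} T) {φ : SchemaSentence} :
    φ ∈ validities T ↔ ∀ ψ : (n : ℕ) → ℕ → L.Formula (Fin n),
      (∀ n i, (ψ n i).freeVarFinset = Finset.univ) → φ.Realize (substRel M ψ) Fin.elim0 := by
  simp only [validities, Set.mem_ofPred_eq, mem_iff_realize hclosed hcomplete M, Sentence.Realize,
    Formula.Realize, SchemaFormula.realize_substitute]
  refine forall₂_congr fun ψ _ => iff_of_eq (congrArg _ (Subsingleton.elim _ _))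

theorem HasStrictOrderProperty.of_not_wellFounded {T : L.Theory}
    (M : Theory.ModelType.{u, v, max u v} T) {k : ℕ} (χ : L.Formula (Fin k ⊕ Fin k))
    (hirr : ∀ a : Fin k → M, ¬ χ.Realize (Sum.elim a a))
    (htrans : ∀ a b c : Fin k → M, χ.Realize (Sum.elim a b) → χ.Realize (Sum.elim b c) →
      χ.Realize (Sum.elim a c))
    (h : ¬ WellFounded fun a b : Fin k → M => χ.Realize (Sum.elim a b)) :
    HasStrictOrderProperty T := by
  rw [wellFounded_iff_isEmpty_descending_chain, not_isEmpty_iff] at h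
  obtain ⟨s, hs⟩ := h
  -- The reflexive closure of the converse of `χ`: it is a preorder, and the descending chain
  -- becomes an ascending one.
  let θ : L.Formula (Fin k ⊕ Fin k) :=
    Formula.iInf (fun j => Term.equal (var (.inl j)) (var (.inr j))) ⊔ χ.relabel Sum.swap
  have hθ (a b : Fin k → M) : θ.Realize (Sum.elim a b) ↔ a = b ∨ χ.Realize (Sum.elim b a) := by
    simp only [θ, Formula.realize_sup, Formula.realize_iInf, Formula.realize_equal,
      Formula.realize_relabel, funext_iff, Term.realize_var, Sum.elim_inl, Sum.elim_inr,
      Sum.elim_swap]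
  refine ⟨k, θ, M, fun a => (hθ a a).2 (.inl rfl), fun a b c => ?_, s, fun i => ?_⟩
  · simp only [hθ]
    rintro (rfl | h₁) (rfl | h₂)
    · exact .inl rfl
    · exact .inr h₂
    · exact .inr h₁
    · exact .inr (htrans _ _ _ h₂ h₁)
  · simp only [hθ]
    refine ⟨.inr (hs i), ?_⟩
    rintro (h | h)
    · have := hs i
      rw [h] at this
      exact hirr _ this
    · exact hirr _ (htrans _ _ _ h (hs i))

theorem dom_of_not_mem_validities {T : L.Theory} (hclosed : ClosedUnderConsequence T)
    (hcomplete : T.IsComplete) (hNSOP : ¬ HasStrictOrderProperty T)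
    (M : Theory.ModelType.{u, v, max u v} T) (n : ℕ) {c : Code} {e : ℕ}
    (h : SchemaFormula.tupled n (SchemaFormula.computation c e).neg ∉ validities T) :
    (c.eval e).Dom := by
  rw [mem_validities_iff hclosed hcomplete M] at h
  push Not at h
  obtain ⟨ψ, -, h⟩ := h
  rw [SchemaFormula.realize_tupled, SchemaFormula.realize_neg, not_not] at h
  have ho := h
  rw [SchemaFormula.computation, SchemaFormula.realize_conj, SchemaFormula.realize_conjList] at ho
  obtain ⟨hirr, htrans, -⟩ := SchemaFormula.realize_orderAxioms.1
    fun φ hφ => ho.1 φ (List.mem_append_left _ hφ)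
  let χ : L.Formula (Fin n ⊕ Fin n) := (ψ (n + n) 0).relabel finSumFinEquiv.symm
  have hχ (a b : Fin n → M) :
      SchemaFormula.tupledRel n (substRel M ψ) 0 [a, b] ↔ χ.Realize (Sum.elim a b) := by
    have : [a, b].flatMap List.ofFn = List.ofFn (Fin.append a b) := by
      simp [List.ofFn_fin_append]
    rw [SchemaFormula.tupledRel, this, substRel_ofFn, Formula.realize_relabel]
    rw [Sum.elim_comp_finSumFinEquiv_symm]
  have hswap (a b : Fin n → M) : (χ.relabel Sum.swap).Realize (Sum.elim a b) ↔
      χ.Realize (Sum.elim b a) := by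
    rw [Formula.realize_relabel, Sum.elim_swap]
  simp only [hχ] at hirr htrans
  refine SchemaFormula.dom_of_realize_computation ?_ ?_ h
  · simp only [hχ]
    exact not_not.1 fun hwf => hNSOP (.of_not_wellFounded M χ hirr htrans hwf)
  · simp only [hχ]
    by_contra hwf
    refine hNSOP (.of_not_wellFounded M (χ.relabel Sum.swap) ?_ ?_ ?_)
    · simpa only [hswap] using hirr
    · simp only [hswap]
      exact fun a b c h₁ h₂ => htrans c b a h₂ h₁
    · simpa only [hswap] using hwf

theorem not_mem_validities_of_dom {T : L.Theory} (hclosed : ClosedUnderConsequence T)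
    (hcomplete : T.IsComplete) (M : Theory.ModelType.{u, v, max u v} T) {n : ℕ} (hn : 0 < n)
    (hM : ∀ K, 0 < K → ∃ f : (Fin n → M) → Fin K, Function.Surjective f ∧
      ∀ j, (∅ : Set M).Definable L (f ⁻¹' {j}))
    {c : Code} {e : ℕ} (h : (c.eval e).Dom) :
    SchemaFormula.tupled n (SchemaFormula.computation c e).neg ∉ validities T := by
  obtain ⟨K, hK, hreal⟩ := SchemaFormula.exists_realize_computation_of_dom h
  obtain ⟨f, hf, hdef⟩ := hM K hK
  have key (N i : ℕ) : ∃ φ : L.Formula (Fin N), φ.freeVarFinset = Finset.univ ∧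
      ∀ (x : Fin N → M) (l : List (Fin n → M)), l.flatMap List.ofFn = List.ofFn x →
        (φ.Realize x ↔ SchemaFormula.stdRel K i (l.map f)) := by
    suffices h : ∃ s : Set (Fin N → M), (∅ : Set M).Definable L s ∧
        ∀ (x : Fin N → M) (l : List (Fin n → M)), l.flatMap List.ofFn = List.ofFn x →
          (x ∈ s ↔ SchemaFormula.stdRel K i (l.map f)) by
      obtain ⟨s, hs, h⟩ := h
      obtain ⟨φ, rfl⟩ := Set.empty_definable_iff.1 hs
      obtain ⟨ψ, hψ, hψ'⟩ := φ.exists_freeVarFinset_eq_univ M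
      exact ⟨ψ, hψ, fun x l hl => (hψ' x).trans (h x l hl)⟩
    have hlen (x : Fin N → M) (l : List (Fin n → M)) (hl : l.flatMap List.ofFn = List.ofFn x) :
        N = n * l.length := by
      have := congrArg List.length hl
      simpa [List.length_flatMap, Nat.mul_comm] using this.symm
    by_cases hN : ∃ r, N = n * r
    · obtain ⟨r, rfl⟩ := hN
      -- The pullback of a relation on `Fin K` is a finite union of boxes whose sides are fibres of
      -- `f`.
      refine ⟨⋃ v : {v : Fin r → Fin K // SchemaFormula.stdRel K i (List.ofFn v)},
        ⋂ j, (fun x : Fin (n * r) → M => x ∘ blockIndex j) ⁻¹' (f ⁻¹' {v.1 j}),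
        Set.definable_iUnion_of_finite fun v => Set.definable_iInter_of_finite fun j =>
          (hdef _).preimage_comp _, fun x l hl => ?_⟩
      have hlr : r = l.length := Nat.eq_of_mul_eq_mul_left hn (hlen x l hl)
      have hl' : l = List.ofFn fun j k => x (blockIndex j k) :=
        List.flatMap_ofFn_injective (by simp [hlr]) (hl.trans (List.ofFn_blocks x))
      rw [hl', List.map_ofFn]
      simp only [Set.mem_iUnion, Set.mem_iInter, Set.mem_preimage, Set.mem_singleton_iff]
      constructor
      · rintro ⟨v, hv⟩
        convert v.2 using 2
        exact funext hv
      · exact fun h => ⟨⟨_, h⟩, fun j => rfl⟩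
    -- Arities that are not multiples of `n` do not arise from tupling, so any formula will do.
    · exact ⟨∅, Set.definable_empty, fun x l hl => absurd ⟨_, hlen x l hl⟩ hN⟩
  choose ψ hψ hψ' using key
  intro hmem
  have hmem := (mem_validities_iff hclosed hcomplete M).1 hmem ψ hψ
  rw [SchemaFormula.realize_tupled, SchemaFormula.realize_neg] at hmem
  refine hmem ((SchemaFormula.realize_of_surjective hf fun i l => ?_).2 (hreal _))
  exact hψ' _ i _ l (List.ofFn_get _).symm

/-! ### Back-and-forth and definable partitions, after Ryll-Nardzewski -/

namespace FirstOrder.Language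

variable {L : Language.{u, v}}

section ElementaryRelation

variable {M N : Type*} [L.Structure M] [L.Structure N]

theorem ElementarilyEquivalent.forall_realize_iff (h : M ≅[L] N) {α : Type*} [Finite α]
    (φ : L.Formula α) : (∀ x : α → M, φ.Realize x) ↔ ∀ x : α → N, φ.Realize x := by
  have := h.realize_sentence (Formula.iAlls α (φ.relabel Sum.inr : L.Formula (Empty ⊕ α)))
  simpa [Sentence.Realize, Formula.realize_relabel, Function.comp_def] using this

/-- A relation between structures all of whose tuples preserve first-order formulas. -/
def IsElementaryRel (L : Language.{u, v}) {M N : Type*} [L.Structure M] [L.Structure N]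
    (S : Set (M × N)) : Prop :=
  ∀ (k : ℕ) (t : Fin k → M × N), (∀ i, t i ∈ S) → ∀ φ : L.Formula (Fin k),
    φ.Realize (fun i => (t i).1) ↔ φ.Realize (fun i => (t i).2)

theorem IsElementaryRel.swap {S : Set (M × N)} (h : IsElementaryRel L S) :
    IsElementaryRel L (Prod.swap ⁻¹' S) :=
  fun k t ht φ => (h k (fun i => (t i).swap) ht φ).symm

theorem isElementaryRel_empty (h : M ≅[L] N) : IsElementaryRel L (∅ : Set (M × N)) := by
  intro k t ht φ
  cases k with
  | zero =>
    have := h.forall_realize_iff φ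
    simpa only [Unique.forall_iff, Subsingleton.elim _ (fun i => (t i).1),
      Subsingleton.elim _ (fun i => (t i).2)] using this
  | succ k => exact (ht 0).elim

variable (L) in
/-- The sets of `n`-tuples definable without parameters. -/
def definableSets (M : Type*) [L.Structure M] (n : ℕ) : Set (Set (Fin n → M)) :=
  Set.range fun φ : L.Formula (Fin n) => {x | φ.Realize x}

/-- Whether two formulas define the same set is expressed by a sentence, so definable sets of `M`
determine those of `N`. -/
theorem definableSets_finite_of_elementarilyEquivalent (h : M ≅[L] N) {n : ℕ}
    (hM : (definableSets L M n).Finite) : (definableSets L N n).Finite := by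
  have hfac : (fun φ : L.Formula (Fin n) => {x : Fin n → N | φ.Realize x}).FactorsThrough
      (fun φ : L.Formula (Fin n) => {x : Fin n → M | φ.Realize x}) := by
    intro φ ψ hφψ
    ext x
    have := (h.forall_realize_iff (φ.iff ψ)).1 fun x => Formula.realize_iff.2 (Set.ext_iff.1 hφψ x)
    exact Formula.realize_iff.1 (this x)
  obtain ⟨g, hg⟩ := (Function.factorsThrough_iff _).1 hfac
  rw [definableSets, hg, Set.range_comp]
  exact hM.image _

/-- If there are finitely many definable sets of `n`-tuples, then every type of an `n`-tuple is
isolated. -/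
theorem exists_isolating_formula {n : ℕ} (hM : (definableSets L M n).Finite) (x : Fin n → M) :
    ∃ χ : L.Formula (Fin n), χ.Realize x ∧ ∀ φ : L.Formula (Fin n), φ.Realize x →
      ∀ y : Fin n → M, χ.Realize y → φ.Realize y := by
  have : Finite {s // s ∈ definableSets L M n ∧ x ∈ s} := (hM.sep _).to_subtype
  have hdef : (∅ : Set M).Definable L (⋂ s : {s // s ∈ definableSets L M n ∧ x ∈ s}, s.1) :=
    Set.definable_iInter_of_finite fun s => by
      obtain ⟨φ, hφ⟩ := s.2.1
      exact Set.empty_definable_iff.2 ⟨φ, hφ.symm⟩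
  obtain ⟨χ, hχ⟩ := Set.empty_definable_iff.1 hdef
  have hχ (y : Fin n → M) : χ.Realize y ↔ ∀ φ : L.Formula (Fin n), φ.Realize x → φ.Realize y := by
    have := Set.ext_iff.1 hχ y
    simp only [Set.mem_iInter, Subtype.forall] at this
    refine this.symm.trans ⟨fun h φ hφ => h _ ⟨⟨φ, rfl⟩, hφ⟩, ?_⟩
    rintro h _ ⟨⟨φ, rfl⟩, hφ⟩
    exact h φ hφ
  exact ⟨χ, (hχ x).2 fun _ => id, fun φ hφ y hy => (hχ y).1 hy φ hφ⟩

theorem IsElementaryRel.exists_insert (h : M ≅[L] N)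
    (hM : ∀ n, (definableSets L M n).Finite) {S : Set (M × N)} (hfin : S.Finite)
    (hS : IsElementaryRel L S) (c : M) : ∃ d : N, IsElementaryRel L (insert (c, d) S) := by
  obtain ⟨n, t, -, rfl⟩ : ∃ (n : ℕ) (t : Fin n → M × N), True ∧ Set.range t = S := by
    obtain ⟨n, e⟩ := hfin.to_subtype.exists_equiv_fin
    exact ⟨n, fun i => (e.some.symm i).1, trivial, by
      rw [← Function.comp_def, e.some.symm.surjective.range_comp, Subtype.range_coe]⟩
  obtain ⟨χ, hχ, hiso⟩ := exists_isolating_formula (hM (n + 1)) (Fin.snoc (fun i => (t i).1) c)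
  have hex := (hS n t (fun i => ⟨i, rfl⟩)
    (Formula.iExs (Fin 1) (χ.relabel (finSumFinEquiv.symm : Fin (n + 1) → Fin n ⊕ Fin 1)))).1
    (Formula.realize_iExs.2 ⟨fun _ => c, by
      rwa [Formula.realize_relabel, Sum.elim_comp_finSumFinEquiv_symm, Fin.append_right_eq_snoc]⟩)
  obtain ⟨d, hd⟩ := Formula.realize_iExs.1 hex
  rw [Formula.realize_relabel, Sum.elim_comp_finSumFinEquiv_symm, Fin.append_right_eq_snoc] at hd
  -- As `χ` isolates the type in `M`, the universal closure of `χ → φ` holds in `M`, hence in `N`.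
  have himp (φ : L.Formula (Fin (n + 1))) (hφ : φ.Realize (Fin.snoc (fun i => (t i).1) c)) :
      φ.Realize (Fin.snoc (fun i => (t i).2) (d 0)) :=
    Formula.realize_imp.1 ((h.forall_realize_iff (χ.imp φ)).1
      (fun y => Formula.realize_imp.2 (hiso φ hφ y)) _) hd
  refine ⟨d 0, fun k s hs φ => ?_⟩
  have hidx : ∀ i, ∃ j : Fin (n + 1), s i = (Fin.snoc t (c, d 0) : Fin (n + 1) → M × N) j := by
    intro i
    rcases hs i with hi | ⟨j, hj⟩
    · exact ⟨Fin.last n, by rw [Fin.snoc_last, hi]⟩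
    · exact ⟨j.castSucc, by rw [Fin.snoc_castSucc, hj]⟩
  choose g hg using hidx
  have h₁ : (fun i => (s i).1) = (Fin.snoc (fun i => (t i).1) c : Fin (n + 1) → M) ∘ g := by
    funext i
    rw [hg, Function.comp_apply]
    refine Fin.lastCases ?_ (fun j => ?_) (g i) <;> simp
  have h₂ : (fun i => (s i).2) = (Fin.snoc (fun i => (t i).2) (d 0) : Fin (n + 1) → N) ∘ g := by
    funext i
    rw [hg, Function.comp_apply]
    refine Fin.lastCases ?_ (fun j => ?_) (g i) <;> simp
  rw [h₁, h₂, ← Formula.realize_relabel, ← Formula.realize_relabel]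
  -- The converse follows by applying `himp` to the negated formula.
  refine ⟨himp _, fun h' => ?_⟩
  by_contra hn
  exact Formula.realize_not.1 (himp _ (Formula.realize_not.2 hn)) h'

/-- Preservation of `x = y` makes the relation the graph of a bijection; preservation of `F x = y`
and of atomic relations makes it an isomorphism. -/
theorem IsElementaryRel.nonempty_equiv {S : Set (M × N)} (hS : IsElementaryRel L S)
    (h₁ : ∀ a, ∃ b, (a, b) ∈ S) (h₂ : ∀ b, ∃ a, (a, b) ∈ S) : Nonempty (M ≃[L] N) := by
  choose f hf using h₁
  have heq {a a' : M} {b b' : N} (h : (a, b) ∈ S) (h' : (a', b') ∈ S) : a = a' ↔ b = b' := by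
    have := hS 2 ![(a, b), (a', b')] (by simp [Fin.forall_fin_two, h, h'])
      (Term.equal (var 0) (var 1))
    simpa [Formula.realize_equal] using this
  have hbij : Function.Bijective f := by
    refine ⟨fun a a' h => (heq (hf a) (hf a')).2 h, fun b => ?_⟩
    obtain ⟨a, ha⟩ := h₂ b
    exact ⟨a, (heq (hf a) ha).1 rfl⟩
  refine ⟨⟨Equiv.ofBijective f hbij, fun {n} F x => ?_, fun {n} r x => ?_⟩⟩
  · have := hS (n + 1) (Fin.cons (Structure.funMap F x, f (Structure.funMap F x))
      fun i => (x i, f (x i))) (Fin.cases (hf _) fun i => hf _)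
      (Term.equal (func F fun i => var i.succ) (var 0))
    simpa [Formula.realize_equal, Function.comp_def, eq_comm] using this
  · have := hS n (fun i => (x i, f (x i))) (fun i => hf _) (r.formula fun i => var i)
    simpa [Formula.realize_rel, Function.comp_def] using this.symm

/-- Elementarily equivalent countable structures with finitely many definable sets of `n`-tuples
for every `n` are isomorphic. -/
theorem nonempty_equiv_of_finite_definableSets [Countable M] [Countable N] (h : M ≅[L] N)
    (hM : ∀ n, (definableSets L M n).Finite) : Nonempty (M ≃[L] N) := by
  have hN n := definableSets_finite_of_elementarilyEquivalent h (hM n)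
  let P := {S : Set (M × N) // S.Finite ∧ IsElementaryRel L S}
  have : Encodable (M ⊕ N) := Encodable.ofCountable _
  -- Countably many cofinal requirements: each element of `M` and each element of `N` must occur in
  -- the relation.
  let 𝒟 : M ⊕ N → Order.Cofinal P := Sum.elim
    (fun a => ⟨{S | ∃ b, (a, b) ∈ S.1}, fun S => by
      obtain ⟨b, hb⟩ := S.2.2.exists_insert h hM S.2.1 a
      exact ⟨⟨_, S.2.1.insert _, hb⟩, ⟨b, Set.mem_insert _ _⟩, Set.subset_insert _ _⟩⟩)
    (fun b => ⟨{S | ∃ a, (a, b) ∈ S.1}, fun S => by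
      obtain ⟨a, ha⟩ := S.2.2.swap.exists_insert h.symm hN
        (S.2.1.preimage Prod.swap_injective.injOn) b
      refine ⟨⟨insert (a, b) S.1, S.2.1.insert _, ?_⟩, ⟨a, Set.mem_insert _ _⟩,
        Set.subset_insert _ _⟩
      convert ha.swap using 1
      ext ⟨x, y⟩
      simp [and_comm]⟩)
  let p : P := ⟨∅, Set.finite_empty, isElementaryRel_empty h⟩
  let I := Order.idealOfCofinals p 𝒟
  refine IsElementaryRel.nonempty_equiv (S := {p | ∃ S ∈ I, p ∈ S.1}) ?_ (fun a => ?_) fun b => ?_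
  · intro k t ht φ
    choose S hSI hS using ht
    choose d hd using hSI
    -- The relations form an increasing sequence, so a finite tuple already lies in one of them.
    refine (Order.sequenceOfCofinals p 𝒟 (Finset.univ.sup d)).2.2 k t (fun i => ?_) φ
    exact (hd i).trans (Order.sequenceOfCofinals.monotone p 𝒟
      (Finset.le_sup (Finset.mem_univ i))) (hS i)
  · obtain ⟨S, ⟨b, hb⟩, hS⟩ := Order.cofinal_meets_idealOfCofinals _ 𝒟 (.inl a)
    exact ⟨b, S, hS, hb⟩
  · obtain ⟨S, ⟨a, ha⟩, hS⟩ := Order.cofinal_meets_idealOfCofinals _ 𝒟 (.inr b)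
    exact ⟨a, S, hS, ha⟩

end ElementaryRelation

theorem exists_definable_surjection {M : Type*} [L.Structure M] {n : ℕ}
    (hM : (definableSets L M n).Infinite) {K : ℕ} (hK : 0 < K) :
    ∃ f : (Fin n → M) → Fin K, Function.Surjective f ∧
      ∀ j, (∅ : Set M).Definable L (f ⁻¹' {j}) := by
  classical
  -- Distinct sets in `F` contain different collections of the patterns `τ x`. Thus `2 ^ K` sets
  -- need at least `K` patterns, and the patterns have definable fibres.
  obtain ⟨F, hF, hcard⟩ := hM.exists_subset_card_eq (2 ^ K)
  let τ : (Fin n → M) → Set F := fun x => {D | x ∈ D.1}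
  have hτ : ∀ t, (∅ : Set M).Definable L (τ ⁻¹' {t}) := by
    intro t
    have : τ ⁻¹' {t} = ⋂ D : F, if D ∈ t then D.1 else D.1ᶜ := by
      ext x
      simp only [Set.mem_preimage, Set.mem_singleton_iff, Set.mem_iInter, Set.ext_iff]
      refine forall_congr' fun D => ?_
      by_cases hD : D ∈ t <;> simp [hD, τ]
    rw [this]
    refine Set.definable_iInter_of_finite fun D => ?_
    obtain ⟨φ, hφ⟩ := hF D.2
    have hD : (∅ : Set M).Definable L D.1 := Set.empty_definable_iff.2 ⟨φ, hφ.symm⟩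
    split_ifs
    · exact hD
    · exact hD.compl
  have hle : K ≤ Nat.card (Set.range τ) := by
    have hinj : Function.Injective fun D : F => {t : Set.range τ | D ∈ t.1} := by
      intro D D' h
      refine Subtype.ext (Set.ext fun x => ?_)
      exact Set.ext_iff.1 h ⟨τ x, x, rfl⟩
    have := Nat.card_le_card_of_injective _ hinj
    rw [Nat.card_eq_fintype_card, Fintype.card_coe, hcard, Nat.card_eq_fintype_card,
      Fintype.card_set, ← Nat.card_eq_fintype_card] at this
    exact (Nat.pow_le_pow_iff_right (by norm_num)).1 this
  have : NeZero K := ⟨hK.ne'⟩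
  -- Numbering the patterns and reducing modulo `K` merges them into exactly `K` nonempty pieces.
  let g : Set.range τ → Fin K := fun t => Fin.ofNat K (Finite.equivFin (Set.range τ) t)
  have hg : Function.Surjective g := by
    intro j
    refine ⟨(Finite.equivFin _).symm ⟨j, j.2.trans_le hle⟩, ?_⟩
    simp only [g]
    rw [_root_.Equiv.apply_symm_apply]
    exact Fin.ofNat_val_eq_self j
  refine ⟨fun x => g ⟨τ x, x, rfl⟩, fun j => ?_, fun j => ?_⟩
  · obtain ⟨⟨_, x, rfl⟩, hx⟩ := hg j
    exact ⟨x, hx⟩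
  · have : (fun x => g ⟨τ x, x, rfl⟩) ⁻¹' {j} =
        ⋃ t : {t : Set.range τ // g t = j}, τ ⁻¹' {t.1.1} := by
      ext x
      simp only [Set.mem_preimage, Set.mem_singleton_iff, Set.mem_iUnion]
      constructor
      · exact fun h => ⟨⟨_, h⟩, rfl⟩
      · rintro ⟨⟨⟨_, y, rfl⟩, ht⟩, h⟩
        rw [← ht]
        simp only [h]
    rw [this]
    exact Set.definable_iUnion_of_finite fun t => hτ _

end FirstOrder.Language

theorem mainTheorem6 {L : FirstOrder.Language.{u, v}} [Countable L.Symbols] (T : L.Theory)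
    (hclosed : ClosedUnderConsequence T) (hcomplete : T.IsComplete)
    (hinf : ∃ M : Theory.ModelType.{u, v, max u v} T, Infinite M)
    (hcat : ¬ Cardinal.Categorical (Cardinal.aleph0.{max u v}) T)
    (hNSOP : ¬ HasStrictOrderProperty T) :
    TuringReducible (charFun haltingSet)
      (charFun (SchemaFormula.code '' validities T)) := by
  simp only [Cardinal.Categorical, not_forall] at hcat
  obtain ⟨M, N, hM, hN, hMN⟩ := hcat
  have : Countable M := Cardinal.mk_le_aleph0_iff.1 hM.le
  have : Countable N := Cardinal.mk_le_aleph0_iff.1 hN.le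
  obtain ⟨n, hn⟩ : ∃ n, (definableSets L M n).Infinite := by
    by_contra! h
    exact hMN (nonempty_equiv_of_finite_definableSets (hcomplete.models_elementarily_equivalent M N)
      fun n => h n)
  have hn0 : 0 < n := by
    -- There is only one 0-tuple, hence only finitely many sets of 0-tuples.
    rcases Nat.eq_zero_or_pos n with rfl | h
    · exact absurd (Set.toFinite _) hn
    · exact h
  obtain ⟨c, hc⟩ := exists_code_haltingSet
  refine turingReducible_charFun_of_primrec ((SchemaFormula.PrimrecTupled.computation c).neg n)
    fun e => ?_
  rw [hc, SchemaFormula.code_injective.mem_set_image]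
  exact ⟨not_mem_validities_of_dom hclosed hcomplete M hn0
      fun K hK => exists_definable_surjection hn hK,
    dom_of_not_mem_validities hclosed hcomplete hNSOP M n⟩
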